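/- **Setting.** A project $a=(F,c)$ consists of a distribution $F$ on $[0,\infty)$ with finite mean and a cost $c\ge 0$; its index is the smallest $r\in[-\infty,\infty]$ with $c=\int [y-r]^+\,dF(y)$ (so $r=\infty$ if $c=0$ and $F$ has unbounded support). A principal faces $m$ agents. Agent $k$ has a finite collection $\mathcal A^k=\{a_0^k,\dots,a_{n_k}^k\}$ of projects, of which the principal knows only $a_0^k$; all prizes are independent. The principal commits to a strategy: based on the agents sponsored so far and the prizes they presented, she decides whom to sponsor next or to stop, what to disclose to the agent sponsored next, which presented prize to adopt after stopping (at most one), and what nonnegative wage to pay to each sponsored agent; a wage may depend on all presented prizes, and she may randomize. A sponsored agent searches his projects sequentially with recall, paying the cost of each project he samples, and then presents one prize, either one that he sampled or $0$. The principal's payoff is the value of the adopted prize (zero if none is adopted) minus all wages; an agent's payoff is his wage minus his search costs; all players are risk-neutral. For given collections $\mathcal A=(\mathcal A^k)_k$, the agents play a (possibly mixed) Nash equilibrium given the principal's strategy, the one best for the principal being selected. The payoff guarantee of a strategy is the infimum of the principal's resulting expected payoff over all $\mathcal A$ with $a_0^k\in\mathcal A^k$ for every $k$, and a strategy is robustly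 optimal if it maximizes the payoff guarantee over all strategies of the principal. **Proposition.** Let $r_0^k$ be the index of $a_0^k$, let the agents be numbered so that $r_0^1\ge r_0^2\ge\dots\ge r_0^m$, and suppose $r_0^1\ge 0$. Then the following strategy of the principal is robustly optimal, whatever she discloses to the agents. In round $k=1,2,\dots,m$ she sponsors agent $k$ and offers him the $r_0^k$-debt contract, which pays him $[y^k-r_0^k]^+$ when he presents the prize $y^k$ (and pays $0$ if $r_0^k=\infty$). After seeing $y^k$, she stops and adopts the highest prize presented so far, $\max\{y^1,\dots,y^k\}$, if it is higher than $r_0^{k+1}$ or if $k=m$; otherwise she continues to round $k+1$. -/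

import Mathlib

open MeasureTheory
open scoped NNReal ENNReal

noncomputable section

namespace RobustSearch

/-- A project (Pandora's box): a prize distribution on the nonnegative reals with finite
expectation, and a nonnegative cost of learning the realized prize. -/
structure Project where
  law : Measure ℝ≥0
  isProb : IsProbabilityMeasure law
  finiteMean : ∫⁻ y, (y : ℝ≥0∞) ∂law ≠ ⊤
  cost : ℝ≥0

attribute [instance] Project.isProb

/-- The index (reservation value) of a project: the smallest `r`, in the extended reals, with
`cost = ∫ [y - r]⁺ dF(y)`. The value `⊤` occurs when the cost is zero and the prize is
unbounded; the index is negative when the cost exceeds the expected prize. -/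
def Project.index (a : Project) : EReal :=
  sInf {r : EReal | ∫⁻ y, (((y : ℝ) : EReal) - r).toENNReal ∂a.law = (a.cost : ℝ≥0∞)}

/-- The `z`-debt contract `w(y) = [y - z]⁺`; for `z = ⊤` the wage is zero. -/
def debt (z : EReal) (y : ℝ≥0) : ℝ≥0 :=
  (((y : ℝ) : EReal) - z).toENNReal.toNNReal

/-- A finite collection `{a_0, ..., a_n}` of projects. -/
structure ProjectSet where
  n : ℕ
  project : Fin (n + 1) → Project

/-! ### Agents -/

/-- A search strategy of an agent who has the projects `0, ..., n`. A decision may depend on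
a private random draw (so mixed strategies are included), on the message received from the
principal when sponsored, on the set `T` of projects sampled so far, and on their realized
prizes.
* `next` gives the project to sample next, or `none` to cease searching;
* `present` gives the sampled project whose prize is presented, or `none` to present the
  prize zero. -/
structure AgentStrategy (M : Type) [MeasurableSpace M] (n : ℕ) where
  next : (T : Finset (Fin (n + 1))) → unitInterval × M × (T → ℝ≥0) → Option (Fin (n + 1))
  next_notMem : ∀ T p i, next T p = some i → i ∉ T
  next_measurable : ∀ T i, MeasurableSet {p | next T p = some i}
  present : (T : Finset (Fin (n + 1))) → unitInterval × M × (T → ℝ≥0) → Option T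
  present_measurable : ∀ T i, MeasurableSet {p | present T p = some i}

namespace AgentStrategy

variable {M : Type} [MeasurableSpace M] {n : ℕ}

/-- One step of the search: `T` is the set of projects sampled so far, `v` the agent's private
random draw, `μ` the message received, and `x` the vector of all prizes, of which only the
prizes of projects in `T` are used. -/
def searchStep (σ : AgentStrategy M n) (v : unitInterval) (μ : M) (x : Fin (n + 1) → ℝ≥0)
    (T : Finset (Fin (n + 1))) : Finset (Fin (n + 1)) :=
  match σ.next T (v, μ, fun i => x i) with
  | none => T
  | some i => insert i T

/-- The set of projects that are sampled in total. There are `n + 1` projects, none is sampled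
twice, and a stopped search stays where it is, so `n + 1` steps exhaust the search. -/
def sampled (σ : AgentStrategy M n) (v : unitInterval) (μ : M) (x : Fin (n + 1) → ℝ≥0) :
    Finset (Fin (n + 1)) :=
  (σ.searchStep v μ x)^[n + 1] ∅

/-- The prize that is presented at the end of the search. -/
def presented (σ : AgentStrategy M n) (v : unitInterval) (μ : M) (x : Fin (n + 1) → ℝ≥0) :
    ℝ≥0 :=
  match σ.present (σ.sampled v μ x) (v, μ, fun i => x i) with
  | none => 0
  | some i => x i

end AgentStrategy

/-! ### The principal -/

/-- A strategy of the principal who faces `m` agents. A decision may depend on a private random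
draw of the principal, on the set `S` of agents sponsored so far, and on the prizes they have
presented.
* `sponsor` gives the agent to sponsor next, or `none` to stop;
* `disclose` gives the message, in a message space `M` chosen by the principal, that is sent to
  the agent who is sponsored next;
* `wage` gives the payment to each sponsored agent once sponsoring has stopped: contracts obey
  limited liability, and may depend on all presented prizes, including those of other agents;
* `adopt` gives the agent whose prize is adopted once sponsoring has stopped (`none` for no
  adoption). -/
structure PrincipalStrategy (m : ℕ) where
  M : Type
  instM : MeasurableSpace M
  sponsor : (S : Finset (Fin m)) → unitInterval × (S → ℝ≥0) → Option (Fin m)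
  sponsor_notMem : ∀ S p k, sponsor S p = some k → k ∉ S
  sponsor_measurable : ∀ S k, MeasurableSet {p | sponsor S p = some k}
  disclose : (S : Finset (Fin m)) → unitInterval × (S → ℝ≥0) → M
  disclose_measurable : ∀ S, Measurable (disclose S)
  wage : (S : Finset (Fin m)) → S → unitInterval × (S → ℝ≥0) → ℝ≥0
  wage_measurable : ∀ S k, Measurable (wage S k)
  adopt : (S : Finset (Fin m)) → unitInterval × (S → ℝ≥0) → Option S
  adopt_measurable : ∀ S k, MeasurableSet {p | adopt S p = some k}

attribute [instance] PrincipalStrategy.instM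

/-! ### The play of the game -/

/-- The primitive randomness: the principal's private draw and, for each agent, a private draw
and the prizes of all his projects. -/
abbrev Sample {m : ℕ} (A : Fin m → ProjectSet) : Type :=
  unitInterval × ((k : Fin m) → unitInterval × (Fin ((A k).n + 1) → ℝ≥0))

/-- All draws are independent; private draws are uniform, prizes follow the laws of their
projects. -/
def sampleLaw {m : ℕ} (A : Fin m → ProjectSet) : Measure (Sample A) :=
  (volume : Measure unitInterval).prod
    (Measure.pi fun k =>
      (volume : Measure unitInterval).prod (Measure.pi fun i => ((A k).project i).law))

/-- A profile of search strategies, one for each agent. -/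
abbrev Profile {m : ℕ} (s : PrincipalStrategy m) (A : Fin m → ProjectSet) : Type :=
  (k : Fin m) → AgentStrategy s.M (A k).n

/-- The state of play between two rounds: the set of agents sponsored so far, the prizes they
presented, and the search costs they incurred (both zero for agents not sponsored). -/
structure State (m : ℕ) where
  sponsored : Finset (Fin m)
  prize : Fin m → ℝ≥0
  cost : Fin m → ℝ≥0

section Play

variable {m : ℕ} (s : PrincipalStrategy m) (A : Fin m → ProjectSet) (σ : Profile s A)

/-- What the principal's decisions may depend on in a given state. -/
def record (u : unitInterval) (z : State m) : unitInterval × (z.sponsored → ℝ≥0) :=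
  (u, fun k => z.prize k)

/-- One round: the principal stops, or sponsors an agent, who receives a message, searches,
and presents a prize. -/
def playRound (ω : Sample A) (z : State m) : State m :=
  match s.sponsor z.sponsored (record ω.1 z) with
  | none => z
  | some k =>
    let μ := s.disclose z.sponsored (record ω.1 z)
    { sponsored := insert k z.sponsored
      prize := Function.update z.prize k ((σ k).presented (ω.2 k).1 μ (ω.2 k).2)
      cost := Function.update z.cost k
        (∑ i ∈ (σ k).sampled (ω.2 k).1 μ (ω.2 k).2, ((A k).project i).cost) }

/-- The final state. No agent is sponsored twice and a stopped process stays where it is, so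
`m` rounds exhaust the play. -/
def final (ω : Sample A) : State m :=
  (playRound s A σ ω)^[m] ⟨∅, fun _ => 0, fun _ => 0⟩

/-- The realized wage of agent `k` (zero if he is not sponsored). -/
def wagePaid (ω : Sample A) (k : Fin m) : ℝ≥0 :=
  if h : k ∈ (final s A σ ω).sponsored then
    s.wage (final s A σ ω).sponsored ⟨k, h⟩ (record ω.1 (final s A σ ω))
  else 0

/-- The value of the adopted prize (zero if none is adopted). -/
def adoptedPrize (ω : Sample A) : ℝ≥0 :=
  match s.adopt (final s A σ ω).sponsored (record ω.1 (final s A σ ω)) with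
  | none => 0
  | some k => (final s A σ ω).prize k

/-- The expected payoff of agent `k`: expected wage, possibly infinite, minus expected search
cost, which is finite. -/
def agentPayoff (k : Fin m) : EReal :=
  ((∫⁻ ω, (wagePaid s A σ ω k : ℝ≥0∞) ∂sampleLaw A : ℝ≥0∞) : EReal)
    - ((∫⁻ ω, ((final s A σ ω).cost k : ℝ≥0∞) ∂sampleLaw A : ℝ≥0∞) : EReal)

/-- The expected payoff of the principal: expected adopted prize, which is finite, minus the
expected sum of all wages, possibly infinite. -/
def principalPayoff : EReal :=
  ((∫⁻ ω, (adoptedPrize s A σ ω : ℝ≥0∞) ∂sampleLaw A : ℝ≥0∞) : EReal)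
    - ((∫⁻ ω, ∑ k, (wagePaid s A σ ω k : ℝ≥0∞) ∂sampleLaw A : ℝ≥0∞) : EReal)

/-- The agents play mutual best responses, given the principal's strategy and the projects
that are really available. -/
def IsEquilibrium : Prop :=
  ∀ (k : Fin m) (τ : AgentStrategy s.M (A k).n),
    agentPayoff s A (Function.update σ k τ) k ≤ agentPayoff s A σ k

end Play

/-- The principal's payoff from `s` when the projects are `A`; among the agents' equilibria the
one best for the principal is selected. -/
def payoffAt {m : ℕ} (s : PrincipalStrategy m) (A : Fin m → ProjectSet) : EReal :=
  ⨆ (σ : Profile s A) (_ : IsEquilibrium s A σ), principalPayoff s A σ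

/-- The payoff guarantee of `s`: the worst case over all collections of projects in which
project `0` of each agent `k` is the known project `a k`. -/
def guarantee {m : ℕ} (a : Fin m → Project) (s : PrincipalStrategy m) : EReal :=
  ⨅ (A : Fin m → ProjectSet) (_ : ∀ k, (A k).project 0 = a k), payoffAt s A

/-- A strategy is robustly optimal if no strategy has a larger payoff guarantee. -/
def IsRobustlyOptimal {m : ℕ} (a : Fin m → Project) (s : PrincipalStrategy m) : Prop :=
  ∀ s' : PrincipalStrategy m, guarantee a s' ≤ guarantee a s

/-! ### The sequential debt strategy -/

open Classical in
/-- The first agent not yet sponsored is sponsored unless some prize presented so far exceeds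
his index `r k`; then, and when no agent is left, the principal stops. -/
def debtSponsor {m : ℕ} (r : Fin m → EReal) (S : Finset (Fin m))
    (p : unitInterval × (S → ℝ≥0)) : Option (Fin m) :=
  if h : (Finset.univ \ S).Nonempty then
    if ∀ j, ((p.2 j : ℝ) : EReal) ≤ r ((Finset.univ \ S).min' h) then
      some ((Finset.univ \ S).min' h)
    else none
  else none

open Classical in
/-- A highest presented prize is adopted (in a tie, the one of the first agent). -/
def adoptHighest {m : ℕ} (S : Finset (Fin m)) (p : unitInterval × (S → ℝ≥0)) : Option S :=
  if h : (Finset.univ.filter fun k : S => ∀ j, p.2 j ≤ p.2 k).Nonempty then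
    some ((Finset.univ.filter fun k : S => ∀ j, p.2 j ≤ p.2 k).min' h)
  else none

theorem debt_measurable (z : EReal) : Measurable (debt z) := by
  have h : Measurable fun y : ℝ≥0 => ((y : ℝ) : EReal) - z := by
    have h1 : Measurable fun y : ℝ≥0 => ((y : ℝ) : EReal) := by fun_prop
    have h2 : Measurable fun x : EReal => x - z :=
      Monotone.measurable fun x y hxy => EReal.sub_le_sub hxy le_rfl
    exact h2.comp h1
  exact h.ereal_toENNReal.ennreal_toNNReal

theorem debtSponsor_notMem {m : ℕ} (r : Fin m → EReal) (S : Finset (Fin m))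
    (p : unitInterval × (S → ℝ≥0)) (k : Fin m) (hk : debtSponsor r S p = some k) : k ∉ S := by
  unfold debtSponsor at hk
  split_ifs at hk with h h'
  have := (Finset.univ \ S).min'_mem h
  rw [Option.some.inj hk] at this
  exact (Finset.mem_sdiff.mp this).2

theorem debtSponsor_measurable {m : ℕ} (r : Fin m → EReal) (S : Finset (Fin m)) (k : Fin m) :
    MeasurableSet {p | debtSponsor r S p = some k} := by
  by_cases h : (Finset.univ \ S).Nonempty
  · by_cases hk : (Finset.univ \ S).min' h = k
    · have : {p | debtSponsor r S p = some k}
          = ⋂ j : S, {p : unitInterval × (S → ℝ≥0) | ((p.2 j : ℝ) : EReal) ≤ r k} := by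
        ext p
        simp [debtSponsor, h, hk]
      rw [this]
      refine MeasurableSet.iInter fun j => measurableSet_le ?_ measurable_const
      have : Measurable fun p : unitInterval × (S → ℝ≥0) => p.2 j := by fun_prop
      fun_prop
    · have : {p | debtSponsor r S p = some k} = ∅ := by
        ext p
        simp [debtSponsor, h, hk]
      rw [this]
      exact MeasurableSet.empty
  · have : {p | debtSponsor r S p = some k} = ∅ := by
      ext p
      simp [debtSponsor, h]
    rw [this]
    exact MeasurableSet.empty

theorem adoptHighest_measurable {m : ℕ} (S : Finset (Fin m)) (k : S) :
    MeasurableSet {p | adoptHighest S p = some k} := by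
  have : {p | adoptHighest S p = some k}
      = (⋂ j : S, {p : unitInterval × (S → ℝ≥0) | p.2 j ≤ p.2 k}) ∩
        ⋂ i : S, ({p : unitInterval × (S → ℝ≥0) | k ≤ i} ∪
          (⋂ j : S, {p : unitInterval × (S → ℝ≥0) | p.2 j ≤ p.2 i})ᶜ) := by
    ext p
    have key : adoptHighest S p = some k ↔
        (∀ j, p.2 j ≤ p.2 k) ∧ ∀ i, (∀ j, p.2 j ≤ p.2 i) → k ≤ i := by
      unfold adoptHighest
      constructor
      · intro hk
        split_ifs at hk with h
        have hm := Finset.min'_mem _ h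
        have hl := fun i hi => Finset.min'_le (Finset.univ.filter fun k : S => ∀ j, p.2 j ≤ p.2 k) i hi
        rw [Option.some.inj hk] at hm
        simp only [Option.some.inj hk] at hl
        exact ⟨(Finset.mem_filter.mp hm).2,
          fun i hi => hl i (Finset.mem_filter.mpr ⟨Finset.mem_univ _, hi⟩)⟩
      · rintro ⟨h1, h2⟩
        have hk : k ∈ Finset.univ.filter fun k : S => ∀ j, p.2 j ≤ p.2 k :=
          Finset.mem_filter.mpr ⟨Finset.mem_univ _, h1⟩
        rw [dif_pos ⟨k, hk⟩]
        congr 1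
        have hm := Finset.min'_mem (Finset.univ.filter fun k : S => ∀ j, p.2 j ≤ p.2 k) ⟨k, hk⟩
        exact le_antisymm (Finset.min'_le _ _ hk) (h2 _ (Finset.mem_filter.mp hm).2)
    simp only [Set.mem_ofPred_eq, key, Set.mem_inter_iff, Set.mem_iInter, Set.mem_union,
      Set.mem_compl_iff]
    refine and_congr_right fun _ => forall_congr' fun i => ?_
    tauto
  have meas : ∀ i : S, MeasurableSet
      (⋂ j : S, {p : unitInterval × (S → ℝ≥0) | p.2 j ≤ p.2 i}) := fun i =>
    MeasurableSet.iInter fun j => measurableSet_le (by fun_prop) (by fun_prop)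
  rw [this]
  exact (meas k).inter (MeasurableSet.iInter fun i => (MeasurableSet.const _).union (meas i).compl)

/-- The sequential debt strategy with debt levels `r`: agents are sponsored in the order
`0, 1, ..., m - 1`, each under the debt contract of level `r k` on his own prize, until some
presented prize exceeds the level of the next agent or no agent is left; then the highest
presented prize is adopted. The messages sent to the agents are arbitrary. -/
def debtStrategy {m : ℕ} (r : Fin m → EReal) (M : Type) [MeasurableSpace M]
    (disclose : (S : Finset (Fin m)) → unitInterval × (S → ℝ≥0) → M)
    (hd : ∀ S, Measurable (disclose S)) : PrincipalStrategy m where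
  M := M
  instM := inferInstance
  sponsor := debtSponsor r
  sponsor_notMem := debtSponsor_notMem r
  sponsor_measurable := debtSponsor_measurable r
  disclose := disclose
  disclose_measurable := hd
  wage := fun _ k p => debt (r k) (p.2 k)
  wage_measurable := fun _ k => (debt_measurable (r k)).comp (by fun_prop)
  adopt := adoptHighest
  adopt_measurable := adoptHighest_measurable

end RobustSearch

end

/-! Write `r i` for the index of a box `i` with value `y i`. Since the decision to open a box is
made before its value is seen, the expected cost of opening it equals the expectation of `[y i - r
i]⁺` on the event that it is opened. Search costs may therefore be replaced, in expectation, by the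
exposure, the sum of `[y i - r i]⁺` over the opened boxes (`lintegral_exposure`), and optimality of
search becomes a pointwise comparison. For any search, the excess of the presented value over an
outside option `r ≥ 0` is at most the largest capped excess `[min (y i) (r i) - r]⁺` plus the
exposure. A search in index order attains this bound (`IndexSearch.cappedExcess_add_sum_le`).

Upper bound (`guarantee_le_benchmark`): if only the known projects exist, the adopted prize is at
most the largest capped known prize plus all exposures. In equilibrium expected wages cover expected
search costs, because idling is possible and wages are nonnegative. Hence no strategy guarantees
more than `benchmark`, the expected largest value of `[min (y k) (r k)]⁺` over the known projects.

Lower bound (`benchmark_le_guarantee`): debt at level `r k` gives a sponsored agent exactly the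
problem of search with outside option `r k`, and he cannot influence whether he is sponsored, so
index search is an equilibrium (`isEquilibrium_indexProfile`). The principal in turn searches in
index order over boxes whose values are the presented prizes and whose thresholds are the `r k`; the
debt wage is precisely the exposure of such a box. The presented prize is at least `min (y k) (r k)`
for the known prize `y k`, so unknown projects never push adopted prize minus wages below the
benchmark, draw by draw (`benchmark_le_principalPayoff`). -/

namespace RobustSearch

/-! ### Excess and capped excess over a threshold -/

/-- The excess `[y - r]⁺` of a prize over a threshold. -/
noncomputable def excess (r : EReal) (y : ℝ≥0) : ℝ≥0∞ := (((y : ℝ) : EReal) - r).toENNReal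

/-- The excess `[min y R - r]⁺` over `r` of a prize capped at `R`. -/
noncomputable def cappedExcess (r R : EReal) (y : ℝ≥0) : ℝ≥0∞ :=
  (min ((y : ℝ) : EReal) R - r).toENNReal

theorem measurable_coe_ereal : Measurable fun y : ℝ≥0 => ((y : ℝ) : EReal) := by fun_prop

theorem measurable_sub_toENNReal (r : EReal) : Measurable fun x : EReal => (x - r).toENNReal :=
  (Monotone.measurable fun _ _ hxy => EReal.sub_le_sub hxy le_rfl).ereal_toENNReal

theorem measurable_excess (r : EReal) : Measurable (excess r) :=
  (measurable_sub_toENNReal r).comp measurable_coe_ereal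

theorem measurable_cappedExcess (r R : EReal) : Measurable (cappedExcess r R) :=
  (measurable_sub_toENNReal r).comp (measurable_coe_ereal.min measurable_const)

theorem excess_mono (r : EReal) : Monotone (excess r) := fun x y h =>
  EReal.toENNReal_le_toENNReal (EReal.sub_le_sub (by exact_mod_cast h) le_rfl)

theorem excess_zero (y : ℝ≥0) : excess 0 y = y := by
  unfold excess
  rw [sub_zero, EReal.real_coe_toENNReal, ENNReal.ofReal_coe_nnreal]

theorem excess_eq_zero {r : EReal} {y : ℝ≥0} (h : ((y : ℝ) : EReal) ≤ r) : excess r y = 0 :=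
  EReal.toENNReal_of_nonpos (EReal.sub_nonpos.2 h)

/-- At `z = ⊥` the excess is `⊤`, which `toNNReal` sends to `0`; this is the only level at which the
two sides differ. -/
theorem coe_debt {z : EReal} (hz : z ≠ ⊥) (y : ℝ≥0) : (debt z y : ℝ≥0∞) = excess z y := by
  unfold debt excess
  refine ENNReal.coe_toNNReal ?_
  rw [EReal.toENNReal_ne_top_iff]
  induction z with
  | bot => exact absurd rfl hz
  | top => simp
  | coe z => rw [← EReal.coe_sub]; exact EReal.coe_ne_top _

/-- No order between `r` and `R` is required, so the bound applies to every box that an arbitrary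
search might open. -/
theorem excess_le_cappedExcess_add (r R : EReal) (y : ℝ≥0) :
    excess r y ≤ cappedExcess r R y + excess R y := by
  unfold excess cappedExcess
  rcases le_total ((y : ℝ) : EReal) R with h | h
  · rw [min_eq_left h]; exact le_self_add
  · rw [min_eq_right h]
    induction R with
    | bot => rw [EReal.coe_sub_bot]; simp
    | top => exact absurd h (by simp)
    | coe R =>
      induction r with
      | bot => simp
      | top => simp
      | coe r =>
        rw [← EReal.coe_sub, ← EReal.coe_sub, ← EReal.coe_sub]
        simp only [EReal.real_coe_toENNReal]
        refine le_trans (ENNReal.ofReal_le_ofReal (le_of_eq ?_)) ENNReal.ofReal_add_le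
        ring

theorem excess_add_excess_le {r R : EReal} {y : ℝ≥0} (h1 : r ≤ R) (h2 : R ≤ ((y : ℝ) : EReal)) :
    (R - r).toENNReal + excess R y ≤ excess r y := by
  unfold excess
  induction R with
  | bot => rw [le_bot_iff.1 h1, EReal.coe_sub_bot]; simp
  | top => exact absurd h2 (by simp)
  | coe R =>
    induction r with
    | bot => simp
    | top => exact absurd h1 (by simp)
    | coe r =>
      rw [← EReal.coe_sub, ← EReal.coe_sub, ← EReal.coe_sub]
      simp only [EReal.real_coe_toENNReal]
      have h1 : r ≤ R := by exact_mod_cast h1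
      have h2 : R ≤ (y : ℝ) := by exact_mod_cast h2
      rw [← ENNReal.ofReal_add (by linarith) (by linarith)]
      refine ENNReal.ofReal_le_ofReal (le_of_eq ?_)
      ring

/-! ### Index rules -/

/-- The state of a search that inspects the boxes with threshold `R i ≥ r` in decreasing order of
thresholds, as long as no inspected value exceeds the next threshold: `T` is the set of inspected
boxes and `X` gives their values. -/
structure IndexSearch {ι : Type*} (r : EReal) (R : ι → EReal) (X : ι → ℝ≥0) (T : Finset ι) :
    Prop where
  le_threshold : ∀ i ∈ T, r ≤ R i
  exposed : ∀ i ∈ T, R i < ((X i : ℝ) : EReal) → ∀ j ∈ T, j ≠ i →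
    ((X j : ℝ) : EReal) ≤ R i ∧ ((X j : ℝ) : EReal) ≤ R j
  upper : ∀ i ∈ T, ∀ j, j ∉ T → r ≤ R j → R j ≤ R i

namespace IndexSearch

variable {ι : Type*} {r : EReal} {R : ι → EReal} {X : ι → ℝ≥0} {T : Finset ι}

theorem empty : IndexSearch r R X ∅ :=
  ⟨by simp, by simp, by simp⟩

theorem congr (h : IndexSearch r R X T) {Y : ι → ℝ≥0} (hY : ∀ j ∈ T, Y j = X j) :
    IndexSearch r R Y T := by
  refine ⟨h.le_threshold, fun i hi hx j hj hji => ?_, h.upper⟩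
  rw [hY i hi] at hx
  rw [hY j hj]
  exact h.exposed i hi hx j hj hji

/-- Old values lie below the new threshold, which lies below all old thresholds. Hence only the
newest box can exceed its own threshold, and the exposure never has more than one nonzero term. -/
theorem insert [DecidableEq ι] (h : IndexSearch r R X T) {i : ι} (hi : i ∉ T) (hr : r ≤ R i)
    (hmax : ∀ j, j ∉ T → r ≤ R j → R j ≤ R i) (hX : ∀ j ∈ T, ((X j : ℝ) : EReal) ≤ R i) :
    IndexSearch r R X (insert i T) := by
  have hT : ∀ j ∈ T, ((X j : ℝ) : EReal) ≤ R j := fun j hj =>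
    (hX j hj).trans (h.upper j hj i hi hr)
  refine ⟨?_, ?_, ?_⟩
  · intro j hj
    rcases Finset.mem_insert.1 hj with rfl | hj
    · exact hr
    · exact h.le_threshold j hj
  · intro k hk hkx j hj hjk
    rcases Finset.mem_insert.1 hk with rfl | hk
    · have hj := (Finset.mem_insert.1 hj).resolve_left hjk
      exact ⟨hX j hj, hT j hj⟩
    · exact absurd hkx (hT k hk).not_gt
  · intro k hk j hj hrj
    have hj' : j ∉ T := fun h => hj (Finset.mem_insert_of_mem h)
    rcases Finset.mem_insert.1 hk with rfl | hk
    · exact hmax j hj' hrj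
    · exact h.upper k hk j hj' hrj

/-- When an index search ends, its best value is at least every capped value plus the total
exposure of the inspected boxes. -/
theorem cappedExcess_add_sum_le (h : IndexSearch r R X T)
    (hdone : ∀ j, j ∉ T → r ≤ R j → ∃ i ∈ T, R j < ((X i : ℝ) : EReal))
    {y : ℝ≥0} (hy : ∀ i ∈ T, X i ≤ y) (Y : ι → ℝ≥0)
    (hY : ∀ j ∈ T, min ((Y j : ℝ) : EReal) (R j) ≤ ((X j : ℝ) : EReal)) (j : ι) :
    cappedExcess r (R j) (Y j) + ∑ i ∈ T, excess (R i) (X i) ≤ excess r y := by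
  classical
  -- If some box `i` exceeds its threshold, all capped values are at most `R i`, and `[X i - r]⁺`
  -- splits at `R i`. Otherwise the exposure vanishes and only the capped values remain to be
  -- compared with `y`.
  by_cases hex : ∃ i ∈ T, R i < ((X i : ℝ) : EReal)
  · obtain ⟨i, hi, hx⟩ := hex
    have hsum : ∑ i ∈ T, excess (R i) (X i) = excess (R i) (X i) := by
      refine Finset.sum_eq_single_of_mem i hi fun k hk hki => ?_
      exact excess_eq_zero (h.exposed i hi hx k hk hki).2
    rw [hsum]
    have hc : cappedExcess r (R j) (Y j) ≤ (R i - r).toENNReal := by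
      by_cases hrj : r ≤ R j
      · refine EReal.toENNReal_le_toENNReal (EReal.sub_le_sub ?_ le_rfl)
        by_cases hj : j ∈ T
        · by_cases hji : j = i
          · subst hji; exact min_le_right _ _
          · exact (hY j hj).trans (h.exposed i hi hx j hj hji).1
        · exact (min_le_right _ _).trans (h.upper i hi j hj hrj)
      · unfold cappedExcess
        rw [EReal.toENNReal_of_nonpos]
        · exact zero_le
        · exact EReal.sub_nonpos.2 ((min_le_right _ _).trans (not_le.1 hrj).le)
    calc _ ≤ (R i - r).toENNReal + excess (R i) (X i) := by gcongr
      _ ≤ excess r (X i) := excess_add_excess_le (h.le_threshold i hi) hx.le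
      _ ≤ excess r y := excess_mono r (hy i hi)
  · push Not at hex
    rw [Finset.sum_eq_zero fun i hi => excess_eq_zero (hex i hi), add_zero]
    by_cases hrj : r ≤ R j
    · refine EReal.toENNReal_le_toENNReal (EReal.sub_le_sub ?_ le_rfl)
      by_cases hj : j ∈ T
      · exact (hY j hj).trans (by exact_mod_cast hy j hj)
      · obtain ⟨i, hi, hlt⟩ := hdone j hj hrj
        refine (min_le_right _ _).trans (hlt.le.trans ?_)
        exact_mod_cast hy i hi
    · unfold cappedExcess
      rw [EReal.toENNReal_of_nonpos]
      · exact zero_le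
      · exact EReal.sub_nonpos.2 ((min_le_right _ _).trans (not_le.1 hrj).le)

end IndexSearch

/-! ### The index equation -/

theorem Project.exists_index_eq (a : Project) : ∃ r, ∫⁻ y, excess r y ∂a.law = a.cost := by
  rcases eq_or_ne a.cost 0 with hc | hc
  · refine ⟨⊤, ?_⟩
    simp [excess, hc]
  · have hint : Integrable (fun y : ℝ≥0 => (y : ℝ)) a.law := by
      refine ⟨by fun_prop, ?_⟩
      rw [hasFiniteIntegral_iff_enorm]
      simpa [lt_top_iff_ne_top] using a.finiteMean
    have hex : ∀ (r : ℝ) (y : ℝ≥0), excess r y = ENNReal.ofReal (max ((y : ℝ) - r) 0) := by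
      intro r y
      rw [excess, ← EReal.coe_sub, EReal.real_coe_toENNReal]
      simp
    have hi : ∀ r : ℝ, Integrable (fun y : ℝ≥0 => max ((y : ℝ) - r) 0) a.law := fun r =>
      (hint.sub (integrable_const r)).pos_part
    let G : ℝ → ℝ := fun r => ∫ y, max ((y : ℝ) - r) 0 ∂a.law
    have hG : ∀ r : ℝ, ∫⁻ y, excess r y ∂a.law = ENNReal.ofReal (G r) := by
      intro r
      simp_rw [hex]
      exact (ofReal_integral_eq_lintegral_ofReal (hi r) (ae_of_all _ fun _ => le_max_right _ _)).symm
    have hcont : Continuous G := by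
      refine continuous_iff_continuousAt.2 fun r => ?_
      -- The bound dominates `max (y - s) 0` for all `s` within distance `1` of `r`.
      refine continuousAt_of_dominated (bound := fun y => (y : ℝ) + |r| + 1)
        (Filter.Eventually.of_forall fun s => (hi s).aestronglyMeasurable) ?_
        ((hint.add (integrable_const _)).add (integrable_const _))
        (ae_of_all _ fun y => by fun_prop)
      filter_upwards [Metric.ball_mem_nhds r one_pos] with s hs
      refine ae_of_all _ fun y => ?_
      rw [Real.norm_eq_abs, abs_of_nonneg (le_max_right _ _)]
      rw [Metric.mem_ball, Real.dist_eq] at hs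
      have := abs_lt.1 hs
      have h2 := neg_abs_le r
      have h3 := y.2
      refine max_le ?_ ?_
      · linarith
      · have := abs_nonneg r
        have : (0 : ℝ) ≤ y := h3
        linarith
    -- Prizes are nonnegative, so `y + cost ≥ cost`. Together with `G n → 0` this brackets the
    -- positive cost for the intermediate value theorem.
    have hlow : (a.cost : ℝ) ≤ G (-a.cost) := by
      have : ∫ _, (a.cost : ℝ) ∂a.law ≤ G (-a.cost) := by
        refine integral_mono (integrable_const _) (hi _) fun y => ?_
        refine le_max_of_le_left ?_
        have := y.2
        simp
      simpa using this
    have hlim : Filter.Tendsto (fun n : ℕ => G n) Filter.atTop (nhds 0) := by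
      have := tendsto_integral_of_dominated_convergence (μ := a.law)
        (F := fun (n : ℕ) (y : ℝ≥0) => max ((y : ℝ) - n) 0) (f := fun _ => (0 : ℝ))
        (fun y => (y : ℝ)) (fun n => (hi n).aestronglyMeasurable) hint
        (fun n => ae_of_all _ fun y => ?_) (ae_of_all _ fun y => ?_)
      · simpa using this
      · rw [Real.norm_eq_abs, abs_of_nonneg (le_max_right _ _)]
        refine max_le ?_ y.2
        have : (0 : ℝ) ≤ n := Nat.cast_nonneg n
        linarith
      · obtain ⟨N, hN⟩ := exists_nat_ge (y : ℝ)
        refine tendsto_atTop_of_eventually_const (i₀ := N) fun n hn => ?_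
        rw [max_eq_right]
        have : (N : ℝ) ≤ n := by exact_mod_cast hn
        linarith
    have hcpos : (0 : ℝ) < a.cost := by exact_mod_cast pos_iff_ne_zero.2 hc
    obtain ⟨n, hn⟩ := (hlim.eventually_lt_const hcpos).exists
    obtain ⟨r, hr⟩ := mem_range_of_exists_le_of_exists_ge hcont ⟨_, hn.le⟩ ⟨_, hlow⟩
    refine ⟨r, ?_⟩
    rw [hG, hr, ENNReal.ofReal_coe_nnreal]

theorem excess_iSup_of_tendsto {r : EReal} {u : ℕ → EReal} (hu : Antitone u)
    (hlim : Filter.Tendsto u Filter.atTop (nhds r)) (y : ℝ≥0) :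
    ⨆ n, excess (u n) y = excess r y := by
  refine iSup_eq_of_tendsto (fun n k h => ?_) ?_
  · exact EReal.toENNReal_le_toENNReal (EReal.sub_le_sub le_rfl (hu h))
  · refine (EReal.continuous_toENNReal.tendsto _).comp ?_
    simp only [sub_eq_add_neg]
    have hadd : ContinuousAt (fun p : EReal × EReal => p.1 + p.2) (((y : ℝ) : EReal), -r) :=
      EReal.continuousAt_add (Or.inl (EReal.coe_ne_top _)) (Or.inl (EReal.coe_ne_bot _))
    exact hadd.tendsto.comp
      (tendsto_const_nhds.prodMk_nhds ((continuous_neg.tendsto _).comp hlim))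

/-- The infimum is attained: along solutions decreasing to it the excess increases pointwise, and
monotone convergence carries the equation to the limit. -/
theorem Project.lintegral_excess_index (a : Project) :
    ∫⁻ y, excess a.index y ∂a.law = a.cost := by
  obtain ⟨u, hu, hlim, hmem⟩ := exists_seq_tendsto_sInf
    (S := {r : EReal | ∫⁻ y, (((y : ℝ) : EReal) - r).toENNReal ∂a.law = (a.cost : ℝ≥0∞)})
    a.exists_index_eq (OrderBot.bddBelow _)
  have h1 : ∀ y, excess a.index y = ⨆ n, excess (u n) y := fun y =>
    (excess_iSup_of_tendsto hu hlim y).symm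
  simp_rw [h1]
  rw [lintegral_iSup (fun n => measurable_excess _)]
  · have : ∀ n, ∫⁻ y, excess (u n) y ∂a.law = a.cost := hmem
    simp [this]
  · intro n k h y
    exact EReal.toENNReal_le_toENNReal (EReal.sub_le_sub le_rfl (hu h))

/-- At `⊥` the excess is identically `⊤`, while the cost is finite. -/
theorem Project.index_ne_bot (a : Project) : a.index ≠ ⊥ := by
  intro h
  have := a.lintegral_excess_index
  simp [h, excess] at this

/-! ### Redrawing a coordinate of a product measure -/

theorem lintegral_pi_update {ι : Type*} [Fintype ι] [DecidableEq ι] {X : ι → Type*}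
    [∀ i, MeasurableSpace (X i)] (μ : ∀ i, Measure (X i)) [∀ i, IsProbabilityMeasure (μ i)]
    (i : ι) {f : (∀ i, X i) → ℝ≥0∞} (hf : Measurable f) :
    ∫⁻ x, ∫⁻ y, f (Function.update x i y) ∂μ i ∂Measure.pi μ = ∫⁻ x, f x ∂Measure.pi μ := by
  have hpres : MeasurePreserving (fun p : (∀ i, X i) × X i => Function.update p.1 i p.2)
      ((Measure.pi μ).prod (μ i)) (Measure.pi μ) := by
    have hm : Measurable (fun p : (∀ i, X i) × X i => Function.update p.1 i p.2) := by
      refine measurable_pi_iff.2 fun j => ?_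
      by_cases hj : j = i
      · subst hj; simpa using measurable_snd
      · simp only [Function.update_of_ne hj]
        fun_prop
    refine ⟨hm, (Measure.pi_eq fun s hs => ?_).symm⟩
    rw [Measure.map_apply hm (MeasurableSet.univ_pi hs)]
    -- Overwriting coordinate `i` frees the old one: the preimage of a box is a box with factor
    -- `univ` at `i`, times `s i` for the fresh draw.
    have : (fun p : (∀ i, X i) × X i => Function.update p.1 i p.2) ⁻¹' (Set.univ.pi s)
        = (Set.univ.pi (Function.update s i Set.univ)) ×ˢ (s i) := by
      ext p
      simp only [Set.mem_preimage, Set.mem_univ_pi, Set.mem_prod]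
      constructor
      · intro h
        refine ⟨fun j => ?_, by simpa using h i⟩
        by_cases hj : j = i
        · subst hj; simp
        · simpa [hj] using h j
      · rintro ⟨h1, h2⟩ j
        by_cases hj : j = i
        · subst hj; simpa using h2
        · simpa [hj] using h1 j
    rw [this, Measure.prod_prod, Measure.pi_pi, ← Finset.mul_prod_erase _ _ (Finset.mem_univ i),
      ← Finset.mul_prod_erase _ (fun j => μ j (s j)) (Finset.mem_univ i)]
    have : ∏ x ∈ Finset.univ.erase i, (μ x) (Function.update s i Set.univ x)
        = ∏ x ∈ Finset.univ.erase i, (μ x) (s x) :=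
      Finset.prod_congr rfl fun j hj => by rw [Function.update_of_ne (Finset.ne_of_mem_erase hj)]
    rw [this]
    simp [mul_comm]
  rw [← hpres.lintegral_comp hf]
  exact (lintegral_prod _ (hf.comp hpres.measurable).aemeasurable).symm

section Resample

variable {m : ℕ} {A : Fin m → ProjectSet}

instance : IsProbabilityMeasure (sampleLaw A) := by
  unfold sampleLaw
  infer_instance

/-- Replace the prize of project `i` of agent `k` by `y`. -/
def resample (k : Fin m) (i : Fin ((A k).n + 1)) (ω : Sample A) (y : ℝ≥0) : Sample A :=
  (ω.1, Function.update ω.2 k ((ω.2 k).1, Function.update (ω.2 k).2 i y))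

theorem measurable_resample (k : Fin m) (i : Fin ((A k).n + 1)) :
    Measurable fun p : Sample A × ℝ≥0 => resample k i p.1 p.2 := by
  unfold resample
  refine Measurable.prodMk (by fun_prop) (measurable_pi_iff.2 fun j => ?_)
  by_cases hj : j = k
  · subst hj
    simp only [Function.update_self]
    refine Measurable.prodMk (by fun_prop) (measurable_pi_iff.2 fun l => ?_)
    by_cases hl : l = i
    · subst hl; simpa using measurable_snd
    · simp only [Function.update_of_ne hl]
      fun_prop
  · simp only [Function.update_of_ne hj]
    fun_prop

theorem lintegral_resample (k : Fin m) (i : Fin ((A k).n + 1)) {f : Sample A → ℝ≥0∞}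
    (hf : Measurable f) :
    ∫⁻ ω, ∫⁻ y, f (resample k i ω y) ∂((A k).project i).law ∂sampleLaw A
      = ∫⁻ ω, f ω ∂sampleLaw A := by
  have hF : Measurable fun ω : Sample A =>
      ∫⁻ y, f (resample k i ω y) ∂((A k).project i).law :=
    Measurable.lintegral_prod_right' (f := fun p : Sample A × ℝ≥0 => f (resample k i p.1 p.2))
      (hf.comp (measurable_resample k i))
  unfold sampleLaw
  rw [lintegral_prod _ hF.aemeasurable, lintegral_prod _ hf.aemeasurable]
  refine lintegral_congr fun u => ?_
  have hfu : Measurable fun x => f (u, x) := by fun_prop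
  have hFu : Measurable fun x => ∫⁻ y, f (resample k i (u, x) y) ∂((A k).project i).law :=
    hF.comp (by fun_prop)
  rw [← lintegral_pi_update _ k hFu, ← lintegral_pi_update _ k hfu]
  refine lintegral_congr fun x => ?_
  have hup : Measurable fun y => Function.update x k y := measurable_update x
  have h1 : Measurable fun y => f (u, Function.update x k y) := hfu.comp hup
  have h2 := hFu.comp hup
  rw [lintegral_prod _ h1.aemeasurable]
  refine (lintegral_prod _ h2.aemeasurable).trans ?_
  refine lintegral_congr fun v => ?_
  have h3 : Measurable fun p => f (u, Function.update x k (v, p)) := h1.comp (by fun_prop)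
  rw [← lintegral_pi_update _ i h3]
  simp [resample]

/-- If an event does not depend on the prize of a project, then on this event the expected excess
of the prize over the index equals the cost. -/
theorem lintegral_indicator_excess (k : Fin m) (i : Fin ((A k).n + 1)) {E : Set (Sample A)}
    (hE : MeasurableSet E) (hinv : ∀ ω y, resample k i ω y ∈ E ↔ ω ∈ E) :
    ∫⁻ ω, E.indicator (fun ω => excess ((A k).project i).index ((ω.2 k).2 i)) ω ∂sampleLaw A
      = ∫⁻ ω, E.indicator (fun _ => (((A k).project i).cost : ℝ≥0∞)) ω ∂sampleLaw A := by
  have hg : Measurable fun ω : Sample A => excess ((A k).project i).index ((ω.2 k).2 i) :=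
    (measurable_excess _).comp (by fun_prop)
  rw [← lintegral_resample k i (hg.indicator hE)]
  refine lintegral_congr fun ω => ?_
  by_cases h : ω ∈ E
  · simp only [Set.indicator, hinv, h, if_true]
    simp only [resample, Function.update_self]
    exact ((A k).project i).lintegral_excess_index
  · simp only [Set.indicator, hinv, h, if_false]
    simp

end Resample

/-! ### Discrete measurability -/

/-- Sets of sponsored agents or sampled projects, and optional choices, take finitely many values.
With the discrete σ-algebra they can be treated as random variables. -/
instance finsetMeasurableSpace {α : Type*} : MeasurableSpace (Finset α) := ⊤

instance finsetDiscrete {α : Type*} : DiscreteMeasurableSpace (Finset α) := ⟨fun _ => trivial⟩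

instance optionMeasurableSpace {α : Type*} : MeasurableSpace (Option α) := ⊤

instance optionDiscrete {α : Type*} : DiscreteMeasurableSpace (Option α) := ⟨fun _ => trivial⟩

theorem measurable_option {α β : Type*} [MeasurableSpace α] [Countable β] {f : α → Option β}
    (h : ∀ i, MeasurableSet {p | f p = some i}) : Measurable f := by
  refine measurable_to_countable' fun o => ?_
  cases o with
  | some i => exact h i
  | none =>
    have : f ⁻¹' {none} = (⋃ i, {p | f p = some i})ᶜ := by
      ext p
      simp only [Set.mem_preimage, Set.mem_singleton_iff, Set.mem_compl_iff, Set.mem_iUnion,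
        Set.mem_ofPred_eq, not_exists]
      exact Option.eq_none_iff_forall_ne_some
    rw [this]
    exact (MeasurableSet.iUnion h).compl

/-- Decision rules have a domain that depends on the current set. Freezing the set makes them
ordinary measurable functions, which are then glued over countably many sets. -/
theorem measurable_of_fiber {α ι γ : Type*} [MeasurableSpace α] [MeasurableSpace ι]
    [Countable ι] [MeasurableSingletonClass ι] [MeasurableSpace γ] {t : α → ι} (ht : Measurable t)
    {F : α → ι → γ} (hF : ∀ i, Measurable fun a => F a i) : Measurable fun a => F a (t a) :=
  (measurable_from_prod_countable_left (f := fun p : α × ι => F p.1 p.2) hF).comp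
    (measurable_id.prodMk ht)

/-! ### The search of a single agent -/

namespace AgentStrategy

variable {M : Type} [MeasurableSpace M] {n : ℕ}

theorem searchStep_congr (σ : AgentStrategy M n) (v : unitInterval) (μ : M)
    {x x' : Fin (n + 1) → ℝ≥0} {T : Finset (Fin (n + 1))} (h : ∀ i ∈ T, x i = x' i) :
    σ.searchStep v μ x T = σ.searchStep v μ x' T := by
  have : (fun i : T => x i) = fun i : T => x' i := funext fun i => h i i.2
  unfold searchStep
  rw [this]

theorem subset_searchStep (σ : AgentStrategy M n) (v : unitInterval) (μ : M)
    (x : Fin (n + 1) → ℝ≥0) (T : Finset (Fin (n + 1))) : T ⊆ σ.searchStep v μ x T := by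
  unfold searchStep
  split
  · exact subset_rfl
  · exact Finset.subset_insert _ _

theorem mem_sampled_update (σ : AgentStrategy M n) (v : unitInterval) (μ : M)
    (x : Fin (n + 1) → ℝ≥0) (i : Fin (n + 1)) (y : ℝ≥0) :
    i ∈ σ.sampled v μ (Function.update x i y) ↔ i ∈ σ.sampled v μ x := by
  -- As long as `i` is unsampled both searches see the same prizes and coincide; once it is sampled,
  -- it remains so in both.
  have key : ∀ j, ((σ.searchStep v μ (Function.update x i y))^[j] ∅
        = (σ.searchStep v μ x)^[j] ∅) ∨
      (i ∈ (σ.searchStep v μ (Function.update x i y))^[j] ∅ ∧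
        i ∈ (σ.searchStep v μ x)^[j] ∅) := by
    intro j
    induction j with
    | zero => exact Or.inl rfl
    | succ j ih =>
      simp only [Function.iterate_succ_apply']
      rcases ih with h | ⟨h1, h2⟩
      · by_cases hi : i ∈ (σ.searchStep v μ x)^[j] ∅
        · exact Or.inr ⟨σ.subset_searchStep _ _ _ _ (h ▸ hi), σ.subset_searchStep _ _ _ _ hi⟩
        · left
          rw [h]
          refine σ.searchStep_congr v μ fun l hl => ?_
          rw [Function.update_of_ne]
          rintro rfl
          exact hi hl
      · exact Or.inr ⟨σ.subset_searchStep _ _ _ _ h1, σ.subset_searchStep _ _ _ _ h2⟩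
  rcases key (n + 1) with h | h
  · unfold sampled; rw [h]
  · exact iff_of_true h.1 h.2

/-- When the search ends, the strategy does not want to sample any further project. -/
theorem next_sampled (σ : AgentStrategy M n) (v : unitInterval) (μ : M)
    (x : Fin (n + 1) → ℝ≥0) :
    σ.next (σ.sampled v μ x) (v, μ, fun i => x i) = none := by
  -- A search that is still running after `j` steps has sampled `j` distinct projects; after `n + 1`
  -- steps none is left.
  have key : ∀ j, σ.next ((σ.searchStep v μ x)^[j] ∅) (v, μ, fun i => x i) = none ∨
      ((σ.searchStep v μ x)^[j] ∅).card = j := by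
    intro j
    induction j with
    | zero => exact Or.inr rfl
    | succ j ih =>
      rw [Function.iterate_succ_apply']
      generalize (σ.searchStep v μ x)^[j] ∅ = T at ih ⊢
      by_cases hn : σ.next T (v, μ, fun i => x i) = none
      · have : σ.searchStep v μ x T = T := by unfold searchStep; rw [hn]
        rw [this]
        exact Or.inl hn
      · obtain ⟨i, hi⟩ := Option.ne_none_iff_exists'.1 hn
        have : σ.searchStep v μ x T = insert i T := by unfold searchStep; rw [hi]
        rw [this, Finset.card_insert_of_notMem (σ.next_notMem _ _ _ hi), ih.resolve_left hn]
        exact Or.inr rfl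
  rcases key (n + 1) with h | h
  · exact h
  · change (σ.sampled v μ x).card = n + 1 at h
    have huniv : σ.sampled v μ x = Finset.univ := by
      rw [← Finset.card_eq_iff_eq_univ, h, Fintype.card_fin]
    by_contra hn
    obtain ⟨i, hi⟩ := Option.ne_none_iff_exists'.1 hn
    exact σ.next_notMem _ _ _ hi (huniv ▸ Finset.mem_univ i)

theorem presented_eq (σ : AgentStrategy M n) (v : unitInterval) (μ : M)
    (x : Fin (n + 1) → ℝ≥0) :
    σ.presented v μ x = 0 ∨ ∃ i ∈ σ.sampled v μ x, σ.presented v μ x = x i := by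
  unfold presented
  split
  · exact Or.inl rfl
  · rename_i i _
    exact Or.inr ⟨i, i.2, rfl⟩

theorem measurable_sampled (σ : AgentStrategy M n) :
    Measurable fun p : unitInterval × M × (Fin (n + 1) → ℝ≥0) => σ.sampled p.1 p.2.1 p.2.2 := by
  have key : ∀ j, Measurable fun p : unitInterval × M × (Fin (n + 1) → ℝ≥0) =>
      (σ.searchStep p.1 p.2.1 p.2.2)^[j] ∅ := by
    intro j
    induction j with
    | zero => exact measurable_const
    | succ j ih =>
      simp only [Function.iterate_succ_apply']
      refine measurable_of_fiber (F := fun p T => σ.searchStep p.1 p.2.1 p.2.2 T) ih fun T => ?_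
      have h1 : Measurable fun p : unitInterval × M × (Fin (n + 1) → ℝ≥0) =>
          σ.next T (p.1, p.2.1, fun i => p.2.2 i) :=
        (measurable_option (σ.next_measurable T)).comp (by fun_prop)
      exact (Measurable.of_discrete (f := fun o : Option (Fin (n + 1)) =>
        match o with
        | none => T
        | some i => insert i T)).comp h1
  exact key (n + 1)

theorem measurable_presented (σ : AgentStrategy M n) :
    Measurable fun p : unitInterval × M × (Fin (n + 1) → ℝ≥0) => σ.presented p.1 p.2.1 p.2.2 := by
  have heq : ∀ p : unitInterval × M × (Fin (n + 1) → ℝ≥0), σ.presented p.1 p.2.1 p.2.2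
      = (σ.present (σ.sampled p.1 p.2.1 p.2.2) (p.1, p.2.1, fun i => p.2.2 i)).elim 0
          (fun i => p.2.2 i) := by
    intro p
    unfold presented
    cases σ.present (σ.sampled p.1 p.2.1 p.2.2) (p.1, p.2.1, fun i => p.2.2 i) <;> rfl
  simp only [heq]
  refine measurable_of_fiber (F := fun p T =>
    (σ.present T (p.1, p.2.1, fun i => p.2.2 i)).elim 0 (fun i => p.2.2 i))
    σ.measurable_sampled fun T => ?_
  have h1 : Measurable fun p : unitInterval × M × (Fin (n + 1) → ℝ≥0) =>
      σ.present T (p.1, p.2.1, fun i => p.2.2 i) :=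
    (measurable_option (σ.present_measurable T)).comp (by fun_prop)
  refine measurable_of_fiber (F := fun p o => Option.elim o 0 (fun i => p.2.2 i)) h1 fun o => ?_
  cases o with
  | none => exact measurable_const
  | some i =>
    simp only [Option.elim_some]
    fun_prop

end AgentStrategy

/-! ### The course of play -/

section Play

variable {m : ℕ} (s : PrincipalStrategy m) (A : Fin m → ProjectSet) (σ : Profile s A)

/-- The state of play after `j` rounds. -/
def stage (ω : Sample A) (j : ℕ) : State m :=
  (playRound s A σ ω)^[j] ⟨∅, fun _ => 0, fun _ => 0⟩

/-- The agent sponsored in round `j + 1`. -/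
def choice (ω : Sample A) (j : ℕ) : Option (Fin m) :=
  s.sponsor (stage s A σ ω j).sponsored (record ω.1 (stage s A σ ω j))

/-- The message sent in round `j + 1`. -/
def message (ω : Sample A) (j : ℕ) : s.M :=
  s.disclose (stage s A σ ω j).sponsored (record ω.1 (stage s A σ ω j))

/-- The projects that each agent has sampled in the first `j` rounds. -/
def searched (ω : Sample A) : ℕ → (k : Fin m) → Finset (Fin ((A k).n + 1))
  | 0 => fun _ => ∅
  | j + 1 =>
    match choice s A σ ω j with
    | none => searched ω j
    | some k => Function.update (searched ω j) k
        ((σ k).sampled (ω.2 k).1 (message s A σ ω j) (ω.2 k).2)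

variable {s A σ} {ω : Sample A} {j : ℕ}

theorem stage_succ_none (h : choice s A σ ω j = none) :
    stage s A σ ω (j + 1) = stage s A σ ω j := by
  unfold choice at h
  unfold stage at h ⊢
  rw [Function.iterate_succ_apply', playRound, h]

theorem stage_succ_some {k : Fin m} (h : choice s A σ ω j = some k) :
    stage s A σ ω (j + 1) =
      { sponsored := insert k (stage s A σ ω j).sponsored
        prize := Function.update (stage s A σ ω j).prize k
          ((σ k).presented (ω.2 k).1 (message s A σ ω j) (ω.2 k).2)
        cost := Function.update (stage s A σ ω j).cost k
          (∑ i ∈ (σ k).sampled (ω.2 k).1 (message s A σ ω j) (ω.2 k).2,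
            ((A k).project i).cost) } := by
  unfold choice at h
  unfold message
  unfold stage at h ⊢
  rw [Function.iterate_succ_apply', playRound, h]

theorem searched_succ_none (h : choice s A σ ω j = none) :
    searched s A σ ω (j + 1) = searched s A σ ω j := by
  rw [searched, h]

theorem searched_succ_some {k : Fin m} (h : choice s A σ ω j = some k) :
    searched s A σ ω (j + 1) = Function.update (searched s A σ ω j) k
        ((σ k).sampled (ω.2 k).1 (message s A σ ω j) (ω.2 k).2) := by
  rw [searched, h]

theorem choice_notMem {k : Fin m} (h : choice s A σ ω j = some k) :
    k ∉ (stage s A σ ω j).sponsored :=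
  s.sponsor_notMem _ _ _ h

/-- What is recorded about an agent is the outcome of his search if he has been sponsored, and
zero otherwise. -/
theorem stage_spec (ω : Sample A) (j : ℕ) (k : Fin m) :
    (k ∉ (stage s A σ ω j).sponsored ∧ (stage s A σ ω j).prize k = 0 ∧
      (stage s A σ ω j).cost k = 0 ∧ searched s A σ ω j k = ∅) ∨
    (k ∈ (stage s A σ ω j).sponsored ∧ ∃ μ,
      (stage s A σ ω j).prize k = (σ k).presented (ω.2 k).1 μ (ω.2 k).2 ∧
      (stage s A σ ω j).cost k
        = ∑ i ∈ (σ k).sampled (ω.2 k).1 μ (ω.2 k).2, ((A k).project i).cost ∧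
      searched s A σ ω j k = (σ k).sampled (ω.2 k).1 μ (ω.2 k).2) := by
  induction j with
  | zero => exact Or.inl ⟨Finset.notMem_empty _, rfl, rfl, rfl⟩
  | succ j ih =>
    cases h : choice s A σ ω j with
    | none => rwa [stage_succ_none h, searched_succ_none h]
    | some l =>
      rw [stage_succ_some h, searched_succ_some h]
      by_cases hk : k = l
      · subst hk
        exact Or.inr ⟨Finset.mem_insert_self _ _, message s A σ ω j, by simp, by simp, by simp⟩
      · simpa [hk] using ih

theorem cost_eq_sum (ω : Sample A) (j : ℕ) (k : Fin m) :
    (stage s A σ ω j).cost k = ∑ i ∈ searched s A σ ω j k, ((A k).project i).cost := by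
  rcases stage_spec (s := s) (σ := σ) ω j k with ⟨_, _, h1, h2⟩ | ⟨_, μ, _, h1, h2⟩
  · rw [h1, h2, Finset.sum_empty]
  · rw [h1, h2]

theorem prize_eq (ω : Sample A) (j : ℕ) (k : Fin m) :
    (stage s A σ ω j).prize k = 0 ∨
      ∃ i ∈ searched s A σ ω j k, (stage s A σ ω j).prize k = (ω.2 k).2 i := by
  rcases stage_spec (s := s) (σ := σ) ω j k with ⟨_, h, _⟩ | ⟨_, μ, h1, _, h2⟩
  · exact Or.inl h
  · rw [h1, h2]
    exact (σ k).presented_eq _ _ _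

/-- Two plays that differ only in the behavior or the draws of agent `k` coincide until he is
sponsored, and he is sponsored in both or in neither, with the same message. -/
theorem stage_coupling {σ' : Profile s A} {ω' : Sample A} {k : Fin m} (h1 : ω'.1 = ω.1)
    (h2 : ∀ l, l ≠ k → ω'.2 l = ω.2 l) (h3 : ∀ l, l ≠ k → σ' l = σ l) (j : ℕ) :
    (stage s A σ' ω' j = stage s A σ ω j ∧ k ∉ (stage s A σ ω j).sponsored ∧
      searched s A σ' ω' j k = ∅ ∧ searched s A σ ω j k = ∅) ∨
    (k ∈ (stage s A σ' ω' j).sponsored ∧ k ∈ (stage s A σ ω j).sponsored ∧ ∃ μ,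
      searched s A σ' ω' j k = (σ' k).sampled (ω'.2 k).1 μ (ω'.2 k).2 ∧
      searched s A σ ω j k = (σ k).sampled (ω.2 k).1 μ (ω.2 k).2) := by
  -- No agent is sponsored twice, so his sampled set is frozen after his round, although the two
  -- plays may diverge from then on.
  have persist : ∀ (σ : Profile s A) (ω : Sample A) (j : ℕ),
      k ∈ (stage s A σ ω j).sponsored → k ∈ (stage s A σ ω (j + 1)).sponsored ∧
        searched s A σ ω (j + 1) k = searched s A σ ω j k := by
    intro σ ω j hk
    cases h : choice s A σ ω j with
    | none => rw [stage_succ_none h, searched_succ_none h]; exact ⟨hk, rfl⟩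
    | some l =>
      rw [stage_succ_some h, searched_succ_some h]
      refine ⟨Finset.mem_insert_of_mem hk, Function.update_of_ne ?_ _ _⟩
      rintro rfl
      exact choice_notMem h hk
  induction j with
  | zero => exact Or.inl ⟨rfl, Finset.notMem_empty _, rfl, rfl⟩
  | succ j ih =>
    rcases ih with ⟨hst, hk, hs', hs⟩ | ⟨hk', hk, μ, hs', hs⟩
    · have hch : choice s A σ' ω' j = choice s A σ ω j := by
        unfold choice; rw [hst, h1]
      have hmsg : message s A σ' ω' j = message s A σ ω j := by
        unfold message; rw [hst, h1]
      cases h : choice s A σ ω j with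
      | none =>
        have h' := hch.trans h
        rw [stage_succ_none h, stage_succ_none h', searched_succ_none h, searched_succ_none h']
        exact Or.inl ⟨hst, hk, hs', hs⟩
      | some l =>
        have h' := hch.trans h
        rw [stage_succ_some h, stage_succ_some h', searched_succ_some h, searched_succ_some h',
          hmsg]
        by_cases hl : k = l
        · subst hl
          refine Or.inr ⟨Finset.mem_insert_self _ _, Finset.mem_insert_self _ _,
            message s A σ ω j, ?_, ?_⟩ <;> simp
        · left
          have hlk : l ≠ k := Ne.symm hl
          refine ⟨?_, ?_, ?_, ?_⟩
          · rw [h2 l hlk, h3 l hlk, hst]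
          · simp [hl, hk]
          · rw [Function.update_of_ne hl, hs']
          · rw [Function.update_of_ne hl, hs]
    · obtain ⟨a1, a2⟩ := persist σ' ω' j hk'
      obtain ⟨b1, b2⟩ := persist σ ω j hk
      exact Or.inr ⟨a1, b1, μ, a2.trans hs', b2.trans hs⟩

theorem mem_searched_resample (j : ℕ) (k : Fin m) (i : Fin ((A k).n + 1)) (ω : Sample A)
    (y : ℝ≥0) :
    i ∈ searched s A σ (resample k i ω y) j k ↔ i ∈ searched s A σ ω j k := by
  rcases stage_coupling (s := s) (σ := σ) (σ' := σ) (ω := ω) (ω' := resample k i ω y) (k := k) rfl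
    (fun l hl => Function.update_of_ne hl _ _) (fun _ _ => rfl) j with
    ⟨_, _, h1, h2⟩ | ⟨_, _, μ, h1, h2⟩
  · rw [h1, h2]
  · rw [h1, h2]
    simp only [resample, Function.update_self]
    exact (σ k).mem_sampled_update _ _ _ _ _

theorem mem_sponsored_update (j : ℕ) (k : Fin m) (τ : AgentStrategy s.M (A k).n)
    (ω : Sample A) :
    k ∈ (stage s A (Function.update σ k τ) ω j).sponsored ↔ k ∈ (stage s A σ ω j).sponsored := by
  rcases stage_coupling (s := s) (σ := σ) (σ' := Function.update σ k τ) (ω := ω) (ω' := ω) (k := k)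
    rfl (fun _ _ => rfl) (fun l hl => Function.update_of_ne hl _ _) j with ⟨h, _⟩ | ⟨h1, h2, _⟩
  · rw [h]
  · exact iff_of_true h1 h2

/-- After `m` rounds the principal does not want to sponsor any further agent. -/
theorem choice_final (ω : Sample A) : choice s A σ ω m = none := by
  have key : ∀ j, choice s A σ ω j = none ∨ (stage s A σ ω j).sponsored.card = j := by
    intro j
    induction j with
    | zero => exact Or.inr rfl
    | succ j ih =>
      cases h : choice s A σ ω j with
      | none =>
        left
        unfold choice at h ⊢
        rwa [stage_succ_none h]
      | some k =>
        right
        rw [stage_succ_some h]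
        rw [Finset.card_insert_of_notMem (choice_notMem h), ih.resolve_left (by simp [h])]
  rcases key m with h | h
  · exact h
  · have huniv : (stage s A σ ω m).sponsored = Finset.univ := by
      rw [← Finset.card_eq_iff_eq_univ, h, Fintype.card_fin]
    by_contra hn
    obtain ⟨k, hk⟩ := Option.ne_none_iff_exists'.1 hn
    exact choice_notMem hk (huniv ▸ Finset.mem_univ k)

/-- The three parts need a joint induction, since each choice and message depends on earlier sets
and prizes. Costs are omitted: they are sums over the searched sets. -/
theorem measurable_stage (j : ℕ) :
    (Measurable fun ω : Sample A => (stage s A σ ω j).sponsored) ∧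
    (∀ k, Measurable fun ω : Sample A => (stage s A σ ω j).prize k) ∧
    (∀ k, Measurable fun ω : Sample A => searched s A σ ω j k) := by
  induction j with
  | zero => exact ⟨measurable_const, fun _ => measurable_const, fun _ => measurable_const⟩
  | succ j ih =>
    obtain ⟨hS, hP, hG⟩ := ih
    have hrec : ∀ S : Finset (Fin m), Measurable fun ω : Sample A =>
        ((ω.1, fun k => (stage s A σ ω j).prize k) : unitInterval × (S → ℝ≥0)) := fun S =>
      Measurable.prodMk (by fun_prop) (measurable_pi_iff.2 fun k => hP k)
    have hch : Measurable fun ω : Sample A => choice s A σ ω j :=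
      measurable_of_fiber (F := fun ω S => s.sponsor S (ω.1, fun k => (stage s A σ ω j).prize k))
        hS fun S => (measurable_option (s.sponsor_measurable S)).comp (hrec S)
    have hmsg : Measurable fun ω : Sample A => message s A σ ω j :=
      measurable_of_fiber (F := fun ω S => s.disclose S (ω.1, fun k => (stage s A σ ω j).prize k))
        hS fun S => (s.disclose_measurable S).comp (hrec S)
    have harg : ∀ k, Measurable fun ω : Sample A =>
        ((ω.2 k).1, message s A σ ω j, (ω.2 k).2) := fun k => by fun_prop
    refine ⟨?_, fun k => ?_, fun k => ?_⟩
    · have : (fun ω : Sample A => (stage s A σ ω (j + 1)).sponsored) = fun ω =>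
          (fun p : Option (Fin m) × Finset (Fin m) => p.1.elim p.2 fun k => insert k p.2)
            (choice s A σ ω j, (stage s A σ ω j).sponsored) := by
        funext ω
        cases h : choice s A σ ω j with
        | none => rw [stage_succ_none h]; rfl
        | some l => rw [stage_succ_some h]; rfl
      rw [this]
      exact (Measurable.of_discrete (f := fun p : Option (Fin m) × Finset (Fin m) =>
        p.1.elim p.2 fun k => insert k p.2)).comp (hch.prodMk hS)
    · have : (fun ω : Sample A => (stage s A σ ω (j + 1)).prize k) = fun ω =>
          if choice s A σ ω j = some k then
            (σ k).presented (ω.2 k).1 (message s A σ ω j) (ω.2 k).2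
            else (stage s A σ ω j).prize k := by
        funext ω
        cases h : choice s A σ ω j with
        | none => rw [stage_succ_none h]; simp
        | some l =>
          rw [stage_succ_some h]
          by_cases hk : l = k
          · subst hk; simp
          · simp [hk, Function.update_of_ne (Ne.symm hk)]
      rw [this]
      refine measurable_of_fiber (F := fun ω o => if o = some k then
            (σ k).presented (ω.2 k).1 (message s A σ ω j) (ω.2 k).2
            else (stage s A σ ω j).prize k)
        hch fun o => ?_
      split_ifs
      · exact (σ k).measurable_presented.comp (harg k)
      · exact hP k
    · have : (fun ω : Sample A => searched s A σ ω (j + 1) k) = fun ω =>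
          if choice s A σ ω j = some k then
            (σ k).sampled (ω.2 k).1 (message s A σ ω j) (ω.2 k).2
            else searched s A σ ω j k := by
        funext ω
        cases h : choice s A σ ω j with
        | none => rw [searched_succ_none h]; simp
        | some l =>
          rw [searched_succ_some h]
          by_cases hk : l = k
          · subst hk; simp
          · simp [hk, Function.update_of_ne (Ne.symm hk)]
      rw [this]
      refine measurable_of_fiber (F := fun ω o => if o = some k then
            (σ k).sampled (ω.2 k).1 (message s A σ ω j) (ω.2 k).2
            else searched s A σ ω j k)
        hch fun o => ?_
      split_ifs
      · exact (σ k).measurable_sampled.comp (harg k)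
      · exact hG k

theorem measurableSet_mem_searched (j : ℕ) (k : Fin m) (i : Fin ((A k).n + 1)) :
    MeasurableSet {ω : Sample A | i ∈ searched s A σ ω j k} := by
  have h : Measurable fun ω : Sample A => searched s A σ ω j k := (measurable_stage j).2.2 k
  exact h (MeasurableSet.of_discrete (s := {T : Finset (Fin ((A k).n + 1)) | i ∈ T}))

/-- The total excess of the prizes sampled by agent `k` over the indices of their projects. -/
noncomputable def exposure (σ : Profile s A) (k : Fin m) (ω : Sample A) : ℝ≥0∞ :=
  ∑ i ∈ searched s A σ ω m k, excess ((A k).project i).index ((ω.2 k).2 i)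

theorem exposure_eq_sum_indicator (σ : Profile s A) (k : Fin m) (ω : Sample A) :
    exposure σ k ω = ∑ i, {ω : Sample A | i ∈ searched s A σ ω m k}.indicator
      (fun ω => excess ((A k).project i).index ((ω.2 k).2 i)) ω := by
  unfold exposure
  simp only [Set.indicator, Set.mem_ofPred_eq]
  rw [← Finset.sum_filter]
  simp

theorem measurable_excess_indicator (σ : Profile s A) (k : Fin m) (i : Fin ((A k).n + 1)) :
    Measurable ({ω : Sample A | i ∈ searched s A σ ω m k}.indicator
      (fun ω => excess ((A k).project i).index ((ω.2 k).2 i))) :=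
  Measurable.indicator ((measurable_excess _).comp (by fun_prop))
    (measurableSet_mem_searched m k i)

theorem measurable_exposure (σ : Profile s A) (k : Fin m) : Measurable (exposure σ k) := by
  have : exposure σ k = fun ω => _ := funext (exposure_eq_sum_indicator σ k)
  rw [this]
  exact Finset.measurable_fun_sum _ fun i _ => measurable_excess_indicator σ k i

/-- The expected exposure of an agent equals his expected search cost. -/
theorem lintegral_exposure (σ : Profile s A) (k : Fin m) :
    ∫⁻ ω, exposure σ k ω ∂sampleLaw A = ∫⁻ ω, ((final s A σ ω).cost k : ℝ≥0∞) ∂sampleLaw A := by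
  have hcost : ∀ ω : Sample A, ((final s A σ ω).cost k : ℝ≥0∞)
      = ∑ i, {ω : Sample A | i ∈ searched s A σ ω m k}.indicator
          (fun _ => (((A k).project i).cost : ℝ≥0∞)) ω := by
    intro ω
    have : (final s A σ ω).cost k = _ := cost_eq_sum ω m k
    rw [this]
    simp only [Set.indicator, Set.mem_ofPred_eq]
    rw [← Finset.sum_filter]
    simp
  simp_rw [hcost, exposure_eq_sum_indicator]
  rw [lintegral_finsetSum _ fun i _ => measurable_excess_indicator σ k i,
    lintegral_finsetSum _ fun i _ =>
      measurable_const.indicator (measurableSet_mem_searched m k i)]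
  exact Finset.sum_congr rfl fun i _ => lintegral_indicator_excess k i
    (measurableSet_mem_searched m k i) fun ω y => mem_searched_resample m k i ω y

theorem lintegral_cost_ne_top (σ : Profile s A) (k : Fin m) :
    ∫⁻ ω, ((final s A σ ω).cost k : ℝ≥0∞) ∂sampleLaw A ≠ ⊤ := by
  have hle : ∫⁻ ω, ((final s A σ ω).cost k : ℝ≥0∞) ∂sampleLaw A
      ≤ ∫⁻ _, ((∑ i, ((A k).project i).cost : ℝ≥0) : ℝ≥0∞) ∂sampleLaw A := by
    refine lintegral_mono fun ω => ENNReal.coe_le_coe.2 ?_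
    have : (final s A σ ω).cost k = _ := cost_eq_sum ω m k
    rw [this]
    exact Finset.sum_le_sum_of_subset (Finset.subset_univ _)
  refine ne_top_of_le_ne_top ?_ hle
  simp

end Play

/-! ### The benchmark -/

section Benchmark

variable {m : ℕ} {A : Fin m → ProjectSet}

theorem measurePreserving_prize (k : Fin m) (i : Fin ((A k).n + 1)) :
    MeasurePreserving (fun ω : Sample A => (ω.2 k).2 i) (sampleLaw A) ((A k).project i).law := by
  have h1 := measurePreserving_eval (fun i => ((A k).project i).law) i
  have h2 : MeasurePreserving Prod.snd ((volume : Measure unitInterval).prod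
      (Measure.pi fun i => ((A k).project i).law)) _ := measurePreserving_snd
  have h3 := measurePreserving_eval (fun k => (volume : Measure unitInterval).prod
    (Measure.pi fun i => ((A k).project i).law)) k
  have h4 : MeasurePreserving Prod.snd (sampleLaw A) _ := measurePreserving_snd
  exact h1.comp (h2.comp (h3.comp h4))

theorem lintegral_sum_prize_ne_top :
    ∫⁻ ω : Sample A, ∑ k, ∑ i, ((ω.2 k).2 i : ℝ≥0∞) ∂sampleLaw A ≠ ⊤ := by
  rw [lintegral_finsetSum _ fun k _ => by fun_prop]
  refine ENNReal.sum_ne_top.2 fun k _ => ?_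
  rw [lintegral_finsetSum _ fun i _ => by fun_prop]
  refine ENNReal.sum_ne_top.2 fun i _ => ?_
  rw [(measurePreserving_prize k i).lintegral_comp (f := fun y : ℝ≥0 => (y : ℝ≥0∞))
    (by fun_prop)]
  exact ((A k).project i).finiteMean

/-- The expected payoff from optimal search when the agents have only the projects `a k` and
search on behalf of the principal. -/
noncomputable def benchmark (a : Fin m → Project) : ℝ≥0∞ :=
  ∫⁻ y, ⨆ k, cappedExcess 0 (a k).index (y k) ∂Measure.pi fun k => (a k).law

/-- The known prizes have the same joint law whatever other projects are present. -/
theorem lintegral_iSup_cappedExcess {a : Fin m → Project} (hA : ∀ k, (A k).project 0 = a k) :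
    ∫⁻ ω : Sample A, ⨆ k, cappedExcess 0 (a k).index ((ω.2 k).2 0) ∂sampleLaw A
      = benchmark a := by
  obtain rfl : (fun k => (A k).project 0) = a := funext hA
  have h1 : ∀ k, MeasurePreserving
      (fun p : unitInterval × (Fin ((A k).n + 1) → ℝ≥0) => p.2 0)
      ((volume : Measure unitInterval).prod (Measure.pi fun i => ((A k).project i).law))
      ((A k).project 0).law := fun k =>
    (measurePreserving_eval (fun i => ((A k).project i).law) 0).comp measurePreserving_snd
  have h2 := (measurePreserving_pi _ _ h1).comp
    (measurePreserving_snd : MeasurePreserving Prod.snd (sampleLaw A) _)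
  exact h2.lintegral_comp (f := fun y => ⨆ k, cappedExcess 0 ((A k).project 0).index (y k))
    (Measurable.iSup fun k => (measurable_cappedExcess _ _).comp (measurable_pi_apply k))

theorem prize_final_le {s : PrincipalStrategy m} (σ : Profile s A) (ω : Sample A) (k : Fin m) :
    ((final s A σ ω).prize k : ℝ≥0∞) ≤ ∑ k, ∑ i, ((ω.2 k).2 i : ℝ≥0∞) := by
  rcases prize_eq (s := s) (σ := σ) ω m k with h | ⟨i, _, h⟩
  · change (final s A σ ω).prize k = 0 at h
    rw [h]
    exact zero_le
  · change (final s A σ ω).prize k = _ at h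
    rw [h]
    exact (Finset.single_le_sum (f := fun i => ((ω.2 k).2 i : ℝ≥0∞)) (fun _ _ => zero_le)
      (Finset.mem_univ i)).trans
      (Finset.single_le_sum (f := fun k => ∑ i, ((ω.2 k).2 i : ℝ≥0∞)) (fun _ _ => zero_le)
        (Finset.mem_univ k))

theorem adoptedPrize_eq {s : PrincipalStrategy m} (σ : Profile s A) (ω : Sample A) :
    adoptedPrize s A σ ω = 0 ∨ ∃ k, adoptedPrize s A σ ω = (final s A σ ω).prize k := by
  unfold adoptedPrize
  split
  · exact Or.inl rfl
  · rename_i k _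
    exact Or.inr ⟨k, rfl⟩

theorem lintegral_adoptedPrize_ne_top {s : PrincipalStrategy m} (σ : Profile s A) :
    ∫⁻ ω, (adoptedPrize s A σ ω : ℝ≥0∞) ∂sampleLaw A ≠ ⊤ := by
  refine ne_top_of_le_ne_top (lintegral_sum_prize_ne_top (A := A)) (lintegral_mono fun ω => ?_)
  rcases adoptedPrize_eq σ ω with h | ⟨k, h⟩
  · simp [h]
  · rw [h]; exact prize_final_le σ ω k

end Benchmark

/-! ### Integrals of sums and extended-real differences -/

/-- Superadditivity of the lower integral needs no measurability, so it applies to wages directly.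
-/
theorem sum_lintegral_le {α ι : Type*} [MeasurableSpace α] (μ : Measure α) (s : Finset ι)
    (f : ι → α → ℝ≥0∞) : ∑ i ∈ s, ∫⁻ x, f i x ∂μ ≤ ∫⁻ x, ∑ i ∈ s, f i x ∂μ := by
  classical
  induction s using Finset.induction_on with
  | empty => simp
  | insert i s hi ih =>
    simp only [Finset.sum_insert hi]
    exact (add_le_add le_rfl ih).trans (le_lintegral_add _ _)

theorem coe_sub_le_of_le_add {x y w : ℝ≥0∞} (h : x ≤ w + y) : (x : EReal) - y ≤ w :=
  EReal.sub_le_of_le_add (by exact_mod_cast h)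

theorem le_coe_sub_of_add_le {x y w : ℝ≥0∞} (hy : y ≠ ⊤) (h : w + y ≤ x) :
    (w : EReal) ≤ (x : EReal) - y := by
  refine (EReal.le_sub_iff_add_le (Or.inl ?_) (Or.inl ?_)).2 (by exact_mod_cast h)
  · exact EReal.coe_ennreal_ne_bot _
  · simpa using hy

/-! ### No strategy guarantees more than the benchmark -/

section Upper

/-- The strategy of an agent who does not search. -/
def idle (M : Type) [MeasurableSpace M] (n : ℕ) : AgentStrategy M n where
  next _ _ := none
  next_notMem _ _ _ h := by simp at h
  next_measurable _ _ := by simp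
  present _ _ := none
  present_measurable _ _ := by simp

theorem sampled_idle {M : Type} [MeasurableSpace M] {n : ℕ} (v : unitInterval) (μ : M)
    (x : Fin (n + 1) → ℝ≥0) : (idle M n).sampled v μ x = ∅ :=
  Function.iterate_fixed rfl _

variable {m : ℕ} {s : PrincipalStrategy m} {A : Fin m → ProjectSet} {σ : Profile s A}

/-- Idling costs nothing and, by limited liability, earns a nonnegative wage, so equilibrium payoffs
are nonnegative. -/
theorem IsEquilibrium.cost_le_wage (h : IsEquilibrium s A σ) (k : Fin m) :
    ∫⁻ ω, ((final s A σ ω).cost k : ℝ≥0∞) ∂sampleLaw A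
      ≤ ∫⁻ ω, (wagePaid s A σ ω k : ℝ≥0∞) ∂sampleLaw A := by
  have h0 : 0 ≤ agentPayoff s A σ k := by
    refine le_trans ?_ (h k (idle _ _))
    have : ∀ ω, (final s A (Function.update σ k (idle _ _)) ω).cost k = 0 := by
      intro ω
      rcases stage_spec (s := s) (σ := Function.update σ k (idle _ _)) ω m k with
        ⟨_, _, h, _⟩ | ⟨_, μ, _, h, _⟩
      · exact h
      · rw [Function.update_self, sampled_idle, Finset.sum_empty] at h
        exact h
    unfold agentPayoff
    simp only [this]
    simpa using EReal.coe_ennreal_nonneg _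
  unfold agentPayoff at h0
  have hc := lintegral_cost_ne_top σ k
  rw [EReal.sub_nonneg (Or.inr (by simpa using hc)) (Or.inr (EReal.coe_ennreal_ne_bot _))] at h0
  exact_mod_cast h0

/-- The collections that consist of the known projects only. -/
def onlyKnown (a : Fin m → Project) (k : Fin m) : ProjectSet := ⟨0, fun _ => a k⟩

theorem adoptedPrize_le (a : Fin m → Project) (σ : Profile s (onlyKnown a))
    (ω : Sample (onlyKnown a)) :
    (adoptedPrize s _ σ ω : ℝ≥0∞)
      ≤ (⨆ k, cappedExcess 0 (a k).index ((ω.2 k).2 0)) + ∑ k, exposure σ k ω := by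
  rcases adoptedPrize_eq σ ω with h | ⟨k, h⟩
  · simp [h]
  · rw [h]
    rcases prize_eq (s := s) (σ := σ) ω m k with h | ⟨i, hi, h⟩
    · change (final s _ σ ω).prize k = 0 at h
      simp [h]
    · change (final s _ σ ω).prize k = _ at h
      -- Each collection is a singleton, so any sampled prize is the known one.
      have hi0 : i = 0 := Fin.fin_one_eq_zero i
      rw [h, ← excess_zero]
      refine (excess_le_cappedExcess_add 0 (a k).index _).trans (add_le_add ?_ ?_)
      · rw [hi0]
        exact le_iSup (fun k => cappedExcess 0 (a k).index ((ω.2 k).2 0)) k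
      · refine le_trans ?_ (Finset.single_le_sum (f := fun k => exposure σ k ω)
          (fun _ _ => zero_le) (Finset.mem_univ k))
        exact Finset.single_le_sum
          (f := fun i => excess ((onlyKnown a k).project i).index ((ω.2 k).2 i))
          (fun _ _ => zero_le) hi

theorem guarantee_le_benchmark (a : Fin m → Project) (s : PrincipalStrategy m) :
    guarantee a s ≤ benchmark a := by
  refine iInf₂_le_of_le (onlyKnown a) (fun _ => rfl) (iSup₂_le fun σ hσ => ?_)
  refine coe_sub_le_of_le_add ?_
  calc _ ≤ ∫⁻ ω, (⨆ k, cappedExcess 0 (a k).index ((ω.2 k).2 0)) + ∑ k, exposure σ k ω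
          ∂sampleLaw (onlyKnown a) := lintegral_mono (adoptedPrize_le a σ)
    _ = benchmark a + ∑ k, ∫⁻ ω, exposure σ k ω ∂sampleLaw (onlyKnown a) := by
        rw [lintegral_add_right _ (Finset.measurable_fun_sum _ fun k _ => measurable_exposure σ k),
          lintegral_finsetSum _ fun k _ => measurable_exposure σ k]
        congr 1
        exact lintegral_iSup_cappedExcess (A := onlyKnown a) fun _ => rfl
    _ ≤ benchmark a + ∑ k, ∫⁻ ω, (wagePaid s _ σ ω k : ℝ≥0∞) ∂sampleLaw (onlyKnown a) := by
        refine add_le_add le_rfl (Finset.sum_le_sum fun k _ => ?_)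
        rw [lintegral_exposure]
        exact hσ.cost_le_wage k
    _ ≤ _ := by
        gcongr
        exact sum_lintegral_le _ _ _

end Upper

/-! ### The index strategy of an agent -/

section Highest

variable {m : ℕ} {S : Finset (Fin m)} {p : unitInterval × (S → ℝ≥0)}

theorem adoptHighest_eq_none (h : adoptHighest S p = none) : S = ∅ := by
  classical
  by_contra hS
  have : Nonempty S := (Finset.nonempty_of_ne_empty hS).to_subtype
  obtain ⟨k, -, hk⟩ := Finset.exists_max_image Finset.univ p.2 Finset.univ_nonempty
  unfold adoptHighest at h
  rw [dif_pos ⟨k, Finset.mem_filter.2 ⟨Finset.mem_univ _, fun j => hk j (Finset.mem_univ _)⟩⟩] at h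
  exact absurd h (by simp)

theorem le_of_adoptHighest {k : S} (h : adoptHighest S p = some k) (j : S) : p.2 j ≤ p.2 k := by
  unfold adoptHighest at h
  split_ifs at h with hn
  have hm := Finset.min'_mem _ hn
  rw [Option.some.inj h] at hm
  exact (Finset.mem_filter.1 hm).2 j

end Highest

section IndexStrategy

variable {M : Type} [MeasurableSpace M] {n : ℕ} (R : Fin (n + 1) → EReal) (r : EReal)

open Classical in
/-- A project with the highest index among those not in `T` whose index is at least `r`. -/
noncomputable def bestRemaining (T : Finset (Fin (n + 1))) : Option (Fin (n + 1)) :=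
  if h : (Finset.univ.filter fun i => i ∉ T ∧ r ≤ R i).Nonempty then
    some (Finset.exists_max_image _ R h).choose
  else none

variable {R r}

theorem bestRemaining_eq_none {T : Finset (Fin (n + 1))} (h : bestRemaining R r T = none)
    (j : Fin (n + 1)) (hj : j ∉ T) : ¬ r ≤ R j := by
  intro hr
  unfold bestRemaining at h
  rw [dif_pos ⟨j, by simp [hj, hr]⟩] at h
  exact absurd h (by simp)

theorem bestRemaining_eq_some {T : Finset (Fin (n + 1))} {i : Fin (n + 1)}
    (h : bestRemaining R r T = some i) :
    i ∉ T ∧ r ≤ R i ∧ ∀ j, j ∉ T → r ≤ R j → R j ≤ R i := by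
  unfold bestRemaining at h
  split_ifs at h with hn
  have hs := (Finset.exists_max_image _ R hn).choose_spec
  rw [Option.some.inj h] at hs
  have h1 := (Finset.mem_filter.1 hs.1).2
  exact ⟨h1.1, h1.2, fun j hj hr => hs.2 j (by simp [hj, hr])⟩

variable (R r)

open Classical in
/-- The agent samples the projects with index at least `r` in decreasing order of their indices, as
long as no sampled prize exceeds the index of the next project, and presents a highest prize. -/
noncomputable def indexStrategy : AgentStrategy M n where
  next T p := (bestRemaining R r T).bind fun i =>
    if ∀ j : T, ((p.2.2 j : ℝ) : EReal) ≤ R i then some i else none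
  next_notMem T p i h := by
    cases hb : bestRemaining R r T with
    | none => simp [hb] at h
    | some l =>
      simp only [hb, Option.bind_some] at h
      split_ifs at h
      rw [← Option.some.inj h]
      exact (bestRemaining_eq_some hb).1
  next_measurable T i := by
    cases hb : bestRemaining R r T with
    | none => simp
    | some l =>
      simp only [Option.bind_some]
      by_cases hl : l = i
      · subst hl
        have : {p : unitInterval × M × (T → ℝ≥0) |
            (if ∀ j : T, ((p.2.2 j : ℝ) : EReal) ≤ R l then some l else none) = some l}
            = ⋂ j : T, {p | ((p.2.2 j : ℝ) : EReal) ≤ R l} := by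
          ext p
          simp
        rw [this]
        refine MeasurableSet.iInter fun j => measurableSet_le ?_ measurable_const
        exact measurable_coe_ereal.comp (by fun_prop)
      · have : {p : unitInterval × M × (T → ℝ≥0) |
            (if ∀ j : T, ((p.2.2 j : ℝ) : EReal) ≤ R l then some l else none) = some i} = ∅ := by
          ext p
          simp [hl]
        rw [this]
        exact MeasurableSet.empty
  present T p := adoptHighest T (p.1, p.2.2)
  present_measurable T i := by
    have : Measurable fun p : unitInterval × M × (T → ℝ≥0) => (p.1, p.2.2) := by fun_prop
    exact this (adoptHighest_measurable T i)

variable {R r} (v : unitInterval) (μ : M) (x : Fin (n + 1) → ℝ≥0)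

theorem indexSearch_sampled :
    IndexSearch r R x ((indexStrategy R r : AgentStrategy M n).sampled v μ x) := by
  have key : ∀ j, IndexSearch r R x
      (((indexStrategy R r : AgentStrategy M n).searchStep v μ x)^[j] ∅) := by
    intro j
    induction j with
    | zero => exact IndexSearch.empty
    | succ j ih =>
      rw [Function.iterate_succ_apply']
      generalize ((indexStrategy R r : AgentStrategy M n).searchStep v μ x)^[j] ∅ = T at ih ⊢
      unfold AgentStrategy.searchStep
      split
      · exact ih
      · rename_i i h
        simp only [indexStrategy] at h
        cases hb : bestRemaining R r T with
        | none => simp [hb] at h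
        | some l =>
          simp only [hb, Option.bind_some] at h
          split_ifs at h with hle
          obtain rfl := Option.some.inj h
          obtain ⟨h1, h2, h3⟩ := bestRemaining_eq_some hb
          exact ih.insert h1 h2 h3 fun j hj => hle ⟨j, hj⟩
  exact key (n + 1)

theorem exists_lt_of_notMem_sampled (j : Fin (n + 1))
    (hj : j ∉ (indexStrategy R r : AgentStrategy M n).sampled v μ x) (hr : r ≤ R j) :
    ∃ i ∈ (indexStrategy R r : AgentStrategy M n).sampled v μ x,
      R j < ((x i : ℝ) : EReal) := by
  have h := (indexStrategy R r : AgentStrategy M n).next_sampled v μ x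
  generalize (indexStrategy R r : AgentStrategy M n).sampled v μ x = T at h hj ⊢
  simp only [indexStrategy] at h
  cases hb : bestRemaining R r T with
  | none => exact absurd hr (bestRemaining_eq_none hb j hj)
  | some l =>
    simp only [hb, Option.bind_some] at h
    split_ifs at h with hle
    push Not at hle
    obtain ⟨i, hi⟩ := hle
    exact ⟨i, i.2, ((bestRemaining_eq_some hb).2.2 j hj hr).trans_lt hi⟩

theorem le_presented_indexStrategy (i : Fin (n + 1))
    (hi : i ∈ (indexStrategy R r : AgentStrategy M n).sampled v μ x) :
    x i ≤ (indexStrategy R r : AgentStrategy M n).presented v μ x := by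
  unfold AgentStrategy.presented
  split
  · rename_i h
    rw [adoptHighest_eq_none h] at hi
    simp at hi
  · rename_i k h
    exact le_of_adoptHighest h ⟨i, hi⟩

/-- An eligible project is either sampled, or skipped because a sampled prize beats its index. For
the known project this is what protects the principal against unknown ones. -/
theorem min_le_presented_indexStrategy (j : Fin (n + 1)) (hr : r ≤ R j) :
    min ((x j : ℝ) : EReal) (R j)
      ≤ (((indexStrategy R r : AgentStrategy M n).presented v μ x : ℝ) : EReal) := by
  by_cases hj : j ∈ (indexStrategy R r : AgentStrategy M n).sampled v μ x
  · refine (min_le_left _ _).trans ?_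
    exact_mod_cast le_presented_indexStrategy v μ x j hj
  · obtain ⟨i, hi, hlt⟩ := exists_lt_of_notMem_sampled v μ x j hj hr
    refine (min_le_right _ _).trans (hlt.le.trans ?_)
    exact_mod_cast le_presented_indexStrategy v μ x i hi

/-- Together with the reverse bound `excess_presented_le` for arbitrary strategies, this makes index
search optimal under debt of level `r ≥ 0`. -/
theorem iSup_add_sum_le_excess_indexStrategy :
    (⨆ j, cappedExcess r (R j) (x j))
      + ∑ i ∈ (indexStrategy R r : AgentStrategy M n).sampled v μ x, excess (R i) (x i)
      ≤ excess r ((indexStrategy R r : AgentStrategy M n).presented v μ x) := by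
  rw [ENNReal.iSup_add]
  exact iSup_le fun j => (indexSearch_sampled v μ x).cappedExcess_add_sum_le
    (exists_lt_of_notMem_sampled v μ x) (le_presented_indexStrategy v μ x) x
    (fun _ _ => min_le_left _ _) j

/-- Nonnegativity of `r` covers an agent who presents zero: his debt wage is then zero. -/
theorem excess_presented_le (σ : AgentStrategy M n) (hr : 0 ≤ r) :
    excess r (σ.presented v μ x)
      ≤ (⨆ j, cappedExcess r (R j) (x j)) + ∑ i ∈ σ.sampled v μ x, excess (R i) (x i) := by
  rcases σ.presented_eq v μ x with h | ⟨i, hi, h⟩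
  · rw [h, excess_eq_zero (by simpa using hr)]
    exact zero_le
  · rw [h]
    refine (excess_le_cappedExcess_add r (R i) _).trans (add_le_add ?_ ?_)
    · exact le_iSup (fun j => cappedExcess r (R j) (x j)) i
    · exact Finset.single_le_sum (f := fun i => excess (R i) (x i)) (fun _ _ => zero_le) hi

end IndexStrategy

/-! ### The sequential debt strategy -/

section Debt

theorem debtSponsor_eq_some {m : ℕ} {r : Fin m → EReal} {S : Finset (Fin m)}
    {p : unitInterval × (S → ℝ≥0)} {k : Fin m} (h : debtSponsor r S p = some k) :
    k ∉ S ∧ (∀ l, l ∉ S → k ≤ l) ∧ ∀ j, ((p.2 j : ℝ) : EReal) ≤ r k := by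
  refine ⟨debtSponsor_notMem r S p k h, ?_⟩
  unfold debtSponsor at h
  split_ifs at h with h1 h2
  obtain rfl := Option.some.inj h
  exact ⟨fun l hl => Finset.min'_le _ _ (by simpa using hl), h2⟩

theorem debtSponsor_eq_none {m : ℕ} {r : Fin m → EReal} {S : Finset (Fin m)}
    {p : unitInterval × (S → ℝ≥0)} (h : debtSponsor r S p = none) {l : Fin m} (hl : l ∉ S) :
    ∃ k ≤ l, ∃ j, r k < ((p.2 j : ℝ) : EReal) := by
  have hne : (Finset.univ \ S).Nonempty := ⟨l, by simpa using hl⟩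
  unfold debtSponsor at h
  rw [dif_pos hne] at h
  split_ifs at h with h2
  push Not at h2
  exact ⟨_, Finset.min'_le _ _ (by simpa using hl), h2⟩

variable {m : ℕ} {R : Fin m → EReal} {M : Type} [MeasurableSpace M]
  {disclose : (S : Finset (Fin m)) → unitInterval × (S → ℝ≥0) → M}
  {hd : ∀ S, Measurable (disclose S)} {A : Fin m → ProjectSet}

/-- From the principal's side each agent is a box with threshold `R k` and his presented prize as
value; the outside option is `0`, adopting nothing. No equilibrium behavior is assumed. -/
theorem indexSearch_stage (hord : ∀ j k, j ≤ k → R k ≤ R j)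
    (hpos : ∀ k : Fin m, (k : ℕ) = 0 → 0 ≤ R k)
    (σ : Profile (debtStrategy R M disclose hd) A) (ω : Sample A) (j : ℕ) :
    IndexSearch 0 R (stage _ A σ ω j).prize (stage _ A σ ω j).sponsored := by
  induction j with
  | zero => exact IndexSearch.empty
  | succ j ih =>
    cases h : choice _ A σ ω j with
    | none => rwa [stage_succ_none h]
    | some k =>
      rw [stage_succ_some h]
      obtain ⟨h1, h2, h3⟩ := debtSponsor_eq_some h
      have hk : 0 ≤ R k := by
        -- The first agent sponsored is agent `0`, with nonnegative level; a later one is sponsored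
        -- only if his level is at least some presented prize, hence nonnegative.
        by_cases hS : (stage _ A σ ω j).sponsored = ∅
        · refine hpos k ?_
          have := h2 ⟨0, k.pos⟩ (by rw [hS]; simp)
          exact Nat.le_zero.1 this
        · obtain ⟨l, hl⟩ := Finset.nonempty_of_ne_empty hS
          refine le_trans ?_ (h3 ⟨l, hl⟩)
          exact_mod_cast zero_le
      refine (ih.congr fun l hl => ?_).insert h1 hk (fun l hl _ => hord k l (h2 l hl))
        fun l hl => ?_
      · refine Function.update_of_ne ?_ _ _
        rintro rfl
        exact h1 hl
      · simp only
        rw [Function.update_of_ne]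
        · exact h3 ⟨l, hl⟩
        · rintro rfl
          exact h1 hl

theorem exists_lt_of_notMem_sponsored (hord : ∀ j k, j ≤ k → R k ≤ R j)
    (σ : Profile (debtStrategy R M disclose hd) A) (ω : Sample A) (l : Fin m)
    (hl : l ∉ (final _ A σ ω).sponsored) :
    ∃ k ∈ (final _ A σ ω).sponsored, R l < (((final _ A σ ω).prize k : ℝ) : EReal) := by
  obtain ⟨k, hk, j, hj⟩ := debtSponsor_eq_none (choice_final (σ := σ) ω) hl
  exact ⟨j, j.2, (hord k l hk).trans_lt hj⟩

theorem prize_le_adoptedPrize (σ : Profile (debtStrategy R M disclose hd) A) (ω : Sample A)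
    (k : Fin m) (hk : k ∈ (final _ A σ ω).sponsored) :
    (final _ A σ ω).prize k ≤ adoptedPrize _ A σ ω := by
  unfold adoptedPrize
  split
  · rename_i h
    rw [adoptHighest_eq_none h] at hk
    simp at hk
  · rename_i l h
    exact le_of_adoptHighest h ⟨k, hk⟩

theorem coe_wagePaid (hR : ∀ k, R k ≠ ⊥) (σ : Profile (debtStrategy R M disclose hd) A)
    (ω : Sample A) (k : Fin m) :
    (wagePaid _ A σ ω k : ℝ≥0∞) =
      if k ∈ (final _ A σ ω).sponsored then excess (R k) ((final _ A σ ω).prize k) else 0 := by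
  unfold wagePaid
  split_ifs with h
  · exact coe_debt (hR k) _
  · rfl

end Debt

/-! ### Equilibrium and payoff guarantee under sequential debt -/

section Guarantee

variable {m : ℕ} {a : Fin m → Project} {M : Type} [MeasurableSpace M]
  {disclose : (S : Finset (Fin m)) → unitInterval × (S → ℝ≥0) → M}
  {hd : ∀ S, Measurable (disclose S)} {A : Fin m → ProjectSet}

variable (A M) in
/-- All agents follow index strategies whose thresholds are the indices of their first projects. -/
noncomputable def indexProfile (k : Fin m) : AgentStrategy M (A k).n :=
  indexStrategy (fun i => ((A k).project i).index) ((A k).project 0).index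

theorem isEquilibrium_indexProfile
    (hord : ∀ j k : Fin m, j ≤ k → (a k).index ≤ (a j).index)
    (hpos : ∀ k : Fin m, (k : ℕ) = 0 → 0 ≤ (a k).index)
    (hA : ∀ k, (A k).project 0 = a k) :
    IsEquilibrium (debtStrategy (fun k => (a k).index) M disclose hd) A (indexProfile M A) := by
  classical
  set s := debtStrategy (fun k => (a k).index) M disclose hd
  intro k τ
  have hbot : ∀ k, (a k).index ≠ ⊥ := fun k => (a k).index_ne_bot
  let σ : Profile s A := indexProfile M A
  -- The expectation of `K` bounds agent `k`'s payoff from every deviation and is reached by index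
  -- search. The event in `K` refers to `σ`, but deviations of agent `k` do not alter it.
  let K : Sample A → ℝ≥0∞ := fun ω => if k ∈ (final s A σ ω).sponsored then
    ⨆ j, cappedExcess (a k).index ((A k).project j).index ((ω.2 k).2 j) else 0
  have hdev : ∫⁻ ω, (wagePaid s A (Function.update σ k τ) ω k : ℝ≥0∞) ∂sampleLaw A
      ≤ ∫⁻ ω, K ω ∂sampleLaw A
        + ∫⁻ ω, ((final s A (Function.update σ k τ) ω).cost k : ℝ≥0∞) ∂sampleLaw A := by
    -- Trading expected cost for expected exposure leaves an inequality that holds for every draw.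
    rw [← lintegral_exposure, ← lintegral_add_right _ (measurable_exposure _ k)]
    refine lintegral_mono fun ω => ?_
    change (wagePaid s A (Function.update σ k τ) ω k : ℝ≥0∞) ≤ K ω + _
    rw [coe_wagePaid hbot]
    have hiff : k ∈ (final s A (Function.update σ k τ) ω).sponsored
      ↔ k ∈ (final s A σ ω).sponsored := mem_sponsored_update m k τ ω
    split_ifs with hk
    · have hr : 0 ≤ (a k).index :=
        (indexSearch_stage hord hpos (Function.update σ k τ) ω m).le_threshold k hk
      simp only [K, if_pos (hiff.1 hk)]
      rcases stage_spec (s := s) (σ := Function.update σ k τ) ω m k with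
        ⟨h, _⟩ | ⟨_, μ, h1, _, h2⟩
      · exact absurd hk h
      · unfold exposure
        change (final s A (Function.update σ k τ) ω).prize k = _ at h1
        rw [h1, h2]
        exact excess_presented_le _ μ _ _ hr
    · exact zero_le
  have hidx : ∫⁻ ω, K ω ∂sampleLaw A + ∫⁻ ω, ((final s A σ ω).cost k : ℝ≥0∞) ∂sampleLaw A
      ≤ ∫⁻ ω, (wagePaid s A σ ω k : ℝ≥0∞) ∂sampleLaw A := by
    rw [← lintegral_exposure, ← lintegral_add_right _ (measurable_exposure _ k)]
    refine lintegral_mono fun ω => ?_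
    change K ω + _ ≤ (wagePaid s A σ ω k : ℝ≥0∞)
    rw [coe_wagePaid hbot]
    rcases stage_spec (s := s) (σ := σ) ω m k with ⟨h, _, _, h2⟩ | ⟨hk, μ, h1, _, h2⟩
    · have h : k ∉ (final s A σ ω).sponsored := h
      simp [K, h, exposure, h2]
    · change (final s A σ ω).prize k = _ at h1
      have hk : k ∈ (final s A σ ω).sponsored := hk
      simp only [K, if_pos hk]
      unfold exposure
      rw [if_pos hk, h1, h2, ← hA k]
      exact iSup_add_sum_le_excess_indexStrategy _ μ _
  exact (coe_sub_le_of_le_add hdev).trans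
    (le_coe_sub_of_add_le (lintegral_cost_ne_top σ k) hidx)

theorem benchmark_le_principalPayoff
    (hord : ∀ j k : Fin m, j ≤ k → (a k).index ≤ (a j).index)
    (hpos : ∀ k : Fin m, (k : ℕ) = 0 → 0 ≤ (a k).index)
    (hA : ∀ k, (A k).project 0 = a k) :
    (benchmark a : EReal) ≤ principalPayoff
      (debtStrategy (fun k => (a k).index) M disclose hd) A (indexProfile M A) := by
  classical
  set s := debtStrategy (fun k => (a k).index) M disclose hd
  let σ : Profile s A := indexProfile M A
  have hpt : ∀ ω : Sample A, (⨆ k, cappedExcess 0 (a k).index ((ω.2 k).2 0))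
      + ∑ k, (wagePaid s A σ ω k : ℝ≥0∞) ≤ adoptedPrize s A σ ω := by
    intro ω
    have hw : ∑ k, (wagePaid s A σ ω k : ℝ≥0∞)
        = ∑ k ∈ (final s A σ ω).sponsored, excess (a k).index ((final s A σ ω).prize k) := by
      have : ∀ k, (wagePaid s A σ ω k : ℝ≥0∞) = if k ∈ (final s A σ ω).sponsored then
          excess (a k).index ((final s A σ ω).prize k) else 0 :=
        coe_wagePaid (fun k => (a k).index_ne_bot) σ ω
      simp_rw [this]
      rw [← Finset.sum_filter]
      simp
    -- `ENNReal.iSup_add` requires a nonempty index type, so `m = 0` is separate.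
    rcases isEmpty_or_nonempty (Fin m) with hm | hm
    · simp
    rw [hw, ENNReal.iSup_add, ← excess_zero (adoptedPrize s A σ ω)]
    -- The search values are the presented prizes, but the capped values are those of the known
    -- prizes; index search by the agents supplies the required domination.
    refine iSup_le fun k => (indexSearch_stage hord hpos σ ω m).cappedExcess_add_sum_le
      (fun j hj _ => exists_lt_of_notMem_sponsored hord σ ω j hj)
      (prize_le_adoptedPrize σ ω) (fun k => (ω.2 k).2 0) (fun j hj => ?_) k
    rcases stage_spec (s := s) (σ := σ) ω m j with ⟨h, _⟩ | ⟨_, μ, h1, _⟩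
    · exact absurd hj h
    · rw [h1, ← hA j]
      exact min_le_presented_indexStrategy (R := fun i => ((A j).project i).index) _ μ _ 0 le_rfl
  have hle : benchmark a + ∫⁻ ω, ∑ k, (wagePaid s A σ ω k : ℝ≥0∞) ∂sampleLaw A
      ≤ ∫⁻ ω, (adoptedPrize s A σ ω : ℝ≥0∞) ∂sampleLaw A := by
    rw [← lintegral_iSup_cappedExcess hA]
    exact (le_lintegral_add _ _).trans (lintegral_mono hpt)
  -- Expected wages are finite because, by `hle`, they are bounded by the finite expected adopted
  -- prize.
  exact le_coe_sub_of_add_le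
    (ne_top_of_le_ne_top (lintegral_adoptedPrize_ne_top σ) (le_add_self.trans hle)) hle

theorem benchmark_le_guarantee
    (hord : ∀ j k : Fin m, j ≤ k → (a k).index ≤ (a j).index)
    (hpos : ∀ k : Fin m, (k : ℕ) = 0 → 0 ≤ (a k).index) :
    (benchmark a : EReal) ≤ guarantee a (debtStrategy (fun k => (a k).index) M disclose hd) :=
  le_iInf₂ fun _ hA => le_iSup₂_of_le _ (isEquilibrium_indexProfile hord hpos hA)
    (benchmark_le_principalPayoff hord hpos hA)

end Guarantee

end RobustSearch

/-- There are `m` agents; the principal knows the project `a k` of agent `k`. Agents are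
numbered by decreasing index, and the largest index is nonnegative. -/
theorem proposition5 (m : ℕ) (a : Fin m → RobustSearch.Project)
    (hord : ∀ j k : Fin m, j ≤ k → (a k).index ≤ (a j).index)
    (hpos : ∀ k : Fin m, (k : ℕ) = 0 → 0 ≤ (a k).index)
    (M : Type) [MeasurableSpace M]
    (disclose : (S : Finset (Fin m)) → unitInterval × (S → NNReal) → M)
    (hd : ∀ S, Measurable (disclose S)) :
    RobustSearch.IsRobustlyOptimal a
      (RobustSearch.debtStrategy (fun k => (a k).index) M disclose hd) :=
  fun s => (RobustSearch.guarantee_le_benchmark a s).trans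
    (RobustSearch.benchmark_le_guarantee hord hpos)
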